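/- Let $M$ be a compact Hausdorff space with a finite Radon measure $\mu$, and let $\mathcal E$ be a Dirichlet form on $L^2(M,\mu)$: a nonnegative closed symmetric bilinear form on a dense subspace $\mathcal D(\mathcal E)\subset L^2(M,\mu)$ such that $|v|\in\mathcal D(\mathcal E)$ and $\mathcal E(|v|)\le\mathcal E(v)$ for $v\in\mathcal D(\mathcal E)$, and $\inf\{v,1\}\in\mathcal D(\mathcal E)$ and $\mathcal E(\inf\{v,1\})\le\mathcal E(v)$ for $0\le v\in\mathcal D(\mathcal E)$; here $\mathcal E(v)=\mathcal E(v,v)$. Assume that $\mathcal E$ is * regular: $\mathcal D(\mathcal E)\cap C^0(M)$ is dense in $C^0(M)$ for the uniform norm and in $\mathcal D(\mathcal E)$ for the norm $(\mathcal E(u)+\|u\|_{L^2}^2)^{1/2}$; * strongly local: $\mathcal E(u,v)=0$ whenever $u,v\in\mathcal D(\mathcal E)$ and $u$ is constant in a neighbourhood of $\operatorname{supp} v$. For $u\in\mathcal D(\mathcal E)\cap C^0(M)$ let $\gamma(u,u)$ be its energy measure, i.e. the Radon measure with $\mathcal E(\varphi u,u)-\tfrac12\mathcal E(\varphi,u^2)=\int_M\varphi\,d\gamma(u,u)$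 for all $\varphi\in\mathcal D(\mathcal E)\cap C^0(M)$, and let $$d(x,y)=\sup\{u(x)-u(y): u\in\mathcal D(\mathcal E)\cap C^0(M),\ d\gamma(u,u)\le d\mu\}\in[0,\infty]$$ be the intrinsic distance, where $d\gamma(u,u)\le d\mu$ means that $d\gamma(u,u)=f\,d\mu$ for some function $f\le1$. Assume that $d$ is compatible with the topology of $M$: for every $x$ the balls $B(x,r)=\{y: d(x,y)<r\}$, $r>0$, form a basis of neighbourhoods of $x$. Let $\nu>2$ and $q=\frac{2\nu}{\nu-2}$. For $U\subset M$ let $A_{\mathrm{opt}}(U)\in[0,\infty]$ be the infimum of all $A>0$ for which there is $B>0$ such that $$\|v\|_{L^q}^2\le A\,\mathcal E(v)+B\,\|v\|_{L^2}^2\qquad\text{for all } v\in\mathcal D(\mathcal E)\text{ with }\operatorname{supp}v\subset U$$ (with $\inf\emptyset=\infty$), let $A_{\mathrm{opt}}=A_{\mathrm{opt}}(M)$, and let $$S(U)=\inf\{\mathcal E(u): u\in\mathcal D(\mathcal E),\ \|u\|_{L^q}=1,\ \operatorname{supp}u\subset U\}\in[0,\infty].$$ Then, for every $x\in M$, the limits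 of $A_{\mathrm{opt}}(B(x,r))$ and of $S(B(x,r))$ as $r\searrow0$ exist in $[0,\infty]$, and $$A_{\mathrm{opt}}=\sup_{x\in M}\lim_{r\searrow0}A_{\mathrm{opt}}(B(x,r)).$$ Suppose moreover that $\mu(\{x\})=0$ for every $x\in M$. Put $S_\ell=\inf_{x\in M}\lim_{r\searrow0}S(B(x,r))$. If $A_{\mathrm{opt}}$ is finite, then $$A_{\mathrm{opt}}=\frac1{S_\ell}\qquad(\text{with } 1/\infty=0;\text{ in particular } S_\ell>0).$$ If $V$ is a real-valued $\mu$-integrable function such that $|V|$ is infinitesimally form bounded, i.e. for every $\varepsilon>0$ there is $c(\varepsilon)$ with $\int_M|V|v^2\,d\mu\le\varepsilon\,\mathcal E(v)+c(\varepsilon)\int_M v^2\,d\mu$ for all $v\in\mathcal D(\mathcal E)$, then, with $\mathcal E_V(u)=\mathcal E(u)+\int_M Vu^2\,d\mu$ and $$Y(U)=\inf\{\mathcal E_V(u): u\in\mathcal D(\mathcal E),\ \|u\|_{L^q}=1,\ \operatorname{supp}u\subset U\}\in[-\infty,\infty],$$ the limits of $Y(B(x,r))$ as $r\searrow0$ exist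 in $[-\infty,\infty]$ and $$S_\ell=Y_\ell:=\inf_{x\in M}\lim_{r\searrow0}Y(B(x,r)).$$ -/

import Mathlib

open MeasureTheory Filter Topology
open scoped ENNReal

noncomputable section

/-- A Dirichlet form on `L²(M, μ)`: a nonnegative closed symmetric bilinear form `ℰ` on a dense
subspace `𝒟(ℰ)` of `L²(M, μ)`, which is sub-Markovian in the sense of Beurling and Deny. -/
structure DirichletForm {M : Type*} [MeasurableSpace M] (μ : Measure M) [IsFiniteMeasure μ] where
  /-- the domain `𝒟(ℰ)` -/
  domain : Submodule ℝ (Lp ℝ 2 μ)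
  /-- the bilinear form `ℰ` on `𝒟(ℰ)` -/
  form : LinearMap.BilinForm ℝ domain
  dense_domain : Dense (domain : Set (Lp ℝ 2 μ))
  symm : ∀ u v : domain, form u v = form v u
  nonneg : ∀ u : domain, 0 ≤ form u u
  /-- `𝒟(ℰ)` is complete for the norm `(ℰ(u) + ‖u‖²)^(1/2)` -/
  closed : ∀ u : ℕ → domain,
    (∀ ε > 0, ∃ N, ∀ m ≥ N, ∀ n ≥ N,
      form (u m - u n) (u m - u n) + ‖((u m - u n : domain) : Lp ℝ 2 μ)‖ ^ 2 < ε) →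
    ∃ v : domain, Tendsto
      (fun n => form (u n - v) (u n - v) + ‖((u n - v : domain) : Lp ℝ 2 μ)‖ ^ 2) atTop (𝓝 0)
  /-- if `v ∈ 𝒟(ℰ)`, then `|v| ∈ 𝒟(ℰ)` and `ℰ(|v|) ≤ ℰ(v)` -/
  markov_abs : ∀ v : domain, ∃ h : |(v : Lp ℝ 2 μ)| ∈ domain,
    form ⟨|(v : Lp ℝ 2 μ)|, h⟩ ⟨|(v : Lp ℝ 2 μ)|, h⟩ ≤ form v v
  /-- if `0 ≤ v ∈ 𝒟(ℰ)`, then `inf{v, 1} ∈ 𝒟(ℰ)` and `ℰ(inf{v, 1}) ≤ ℰ(v)` -/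
  markov_inf : ∀ v : domain, 0 ≤ (v : Lp ℝ 2 μ) →
    ∃ h : (v : Lp ℝ 2 μ) ⊓ Lp.const 2 μ (1 : ℝ) ∈ domain,
      form ⟨(v : Lp ℝ 2 μ) ⊓ Lp.const 2 μ (1 : ℝ), h⟩
        ⟨(v : Lp ℝ 2 μ) ⊓ Lp.const 2 μ (1 : ℝ), h⟩ ≤ form v v

namespace DirichletForm

/-- The (closed) support of a class of functions modulo `μ`-null sets: the complement of the
set of points near which the function vanishes almost everywhere. -/
def essSupport {M : Type*} [TopologicalSpace M] [MeasurableSpace M] (μ : Measure M)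
    (f : M → ℝ) : Set M :=
  {x | ∀ O ∈ 𝓝 x, ¬ (∀ᵐ y ∂μ, y ∈ O → f y = 0)}

variable {M : Type*} [TopologicalSpace M] [CompactSpace M] [MeasurableSpace M] [BorelSpace M]
  {μ : Measure M} [IsFiniteMeasure μ]

/-- `𝒟(ℰ) ∩ C⁰(M)`: the continuous functions whose `L²` class lies in the domain. -/
def contDomain (E : DirichletForm μ) : Set C(M, ℝ) :=
  {f | ContinuousMap.toLp 2 μ ℝ f ∈ E.domain}

/-- Regularity: `𝒟(ℰ) ∩ C⁰(M)` is dense in `C⁰(M)` for the uniform norm and in `𝒟(ℰ)` for the norm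
`(ℰ(u) + ‖u‖²)^(1/2)`. -/
def IsRegular (E : DirichletForm μ) : Prop :=
  Dense E.contDomain ∧
  ∀ u : E.domain, ∀ ε > 0, ∃ v : E.domain,
    (∃ f ∈ E.contDomain, ContinuousMap.toLp 2 μ ℝ f = (v : Lp ℝ 2 μ)) ∧
    E.form (u - v) (u - v) + ‖((u - v : E.domain) : Lp ℝ 2 μ)‖ ^ 2 < ε

/-- Strong locality: `ℰ(u, v) = 0` whenever `u` is (almost everywhere) constant in a neighbourhood
of the support of `v`. -/
def IsStronglyLocal (E : DirichletForm μ) : Prop :=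
  ∀ u v : E.domain,
    (∃ O : Set M, IsOpen O ∧ essSupport μ (v : Lp ℝ 2 μ) ⊆ O ∧
      ∃ c : ℝ, ∀ᵐ y ∂μ, y ∈ O → (u : Lp ℝ 2 μ) y = c) →
    E.form u v = 0

/-- `γ` is the energy measure `γ(u, u)` of `u ∈ 𝒟(ℰ) ∩ C⁰(M)`: the Radon measure such that
`ℰ(φ u, u) - ½ ℰ(φ, u²) = ∫ φ dγ` for all `φ ∈ 𝒟(ℰ) ∩ C⁰(M)`. The products `φ u` and `u²` always lie
in `𝒟(ℰ)`, because the bounded functions of `𝒟(ℰ)` form an algebra; so the two memberships stated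
below are no restriction. -/
def IsEnergyMeasure (E : DirichletForm μ) (u : C(M, ℝ)) (γ : Measure M) : Prop :=
  IsFiniteMeasure γ ∧ γ.Regular ∧
  ∃ hu : ContinuousMap.toLp 2 μ ℝ u ∈ E.domain,
    ∀ φ : C(M, ℝ), ∀ hφ : ContinuousMap.toLp 2 μ ℝ φ ∈ E.domain,
      ∃ (hφu : ContinuousMap.toLp 2 μ ℝ (φ * u) ∈ E.domain)
        (huu : ContinuousMap.toLp 2 μ ℝ (u * u) ∈ E.domain),
        E.form ⟨_, hφu⟩ ⟨_, hu⟩ - 1 / 2 * E.form ⟨_, hφ⟩ ⟨_, huu⟩ = ∫ x, φ x ∂γ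

/-- `dγ(u, u) ≤ dμ`: the energy measure of `u` is `f dμ` with a function `f ≤ 1`. -/
def EnergyLe (E : DirichletForm μ) (u : C(M, ℝ)) : Prop :=
  ∃ f : M → ℝ≥0∞, Measurable f ∧ (∀ x, f x ≤ 1) ∧ E.IsEnergyMeasure u (μ.withDensity f)

/-- The intrinsic pseudo-distance
`d(x, y) = sup {u(x) - u(y) : u ∈ 𝒟(ℰ) ∩ C⁰(M), dγ(u, u) ≤ dμ}`, with values in `[0, ∞]`
(the function `u = 0` competes, so the supremum is nonnegative). -/
def dist (E : DirichletForm μ) (x y : M) : ℝ≥0∞ :=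
  ⨆ u ∈ {u : C(M, ℝ) | u ∈ E.contDomain ∧ E.EnergyLe u}, ENNReal.ofReal (u x - u y)

/-- The ball `B(x, r)` of the intrinsic distance. -/
def ball (E : DirichletForm μ) (x : M) (r : ℝ) : Set M :=
  {y | E.dist x y < ENNReal.ofReal r}

/-- The intrinsic distance is compatible with the topology of `M`: at each point the balls
are a basis of neighbourhoods. -/
def DistCompatible (E : DirichletForm μ) : Prop :=
  ∀ x : M, (𝓝 x).HasBasis (fun r : ℝ => 0 < r) (fun r => E.ball x r)

/-- The Sobolev exponent `2ν/(ν-2)`. -/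
def sobolevExponent (ν : ℝ) : ℝ≥0∞ := ENNReal.ofReal (2 * ν / (ν - 2))

/-- The Sobolev inequality `‖v‖²_{2ν/(ν-2)} ≤ A ℰ(v) + B ‖v‖²_2` for all `v ∈ 𝒟(ℰ)` with
support in `U`. -/
def SobolevOn (E : DirichletForm μ) (ν : ℝ) (U : Set M) (A B : ℝ) : Prop :=
  ∀ v : E.domain, essSupport μ (v : Lp ℝ 2 μ) ⊆ U →
    eLpNorm (v : Lp ℝ 2 μ) (sobolevExponent ν) μ ^ 2 ≤
      ENNReal.ofReal (A * E.form v v + B * ‖(v : Lp ℝ 2 μ)‖ ^ 2)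

/-- The optimal Sobolev constant `A_opt(U) ∈ [0, ∞]`: the infimum of the `A > 0` for which the
Sobolev inequality holds for functions supported in `U` with some `B > 0`
(`∞` if there is no such `A`). -/
def optSobolev (E : DirichletForm μ) (ν : ℝ) (U : Set M) : ℝ≥0∞ :=
  ⨅ A ∈ {A : ℝ | 0 < A ∧ ∃ B : ℝ, 0 < B ∧ E.SobolevOn ν U A B}, ENNReal.ofReal A

/-- `S(U) = inf {ℰ(u) : u ∈ 𝒟(ℰ), ‖u‖_{2ν/(ν-2)} = 1, supp u ⊆ U} ∈ [0, ∞]`. -/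
def sobolevInv (E : DirichletForm μ) (ν : ℝ) (U : Set M) : ℝ≥0∞ :=
  ⨅ u ∈ {u : E.domain | eLpNorm (u : Lp ℝ 2 μ) (sobolevExponent ν) μ = 1 ∧
      essSupport μ (u : Lp ℝ 2 μ) ⊆ U},
    ENNReal.ofReal (E.form u u)

/-- `ℰ_V(u) = ℰ(u) + ∫ V u² dμ`. -/
def schrodinger (E : DirichletForm μ) (V : M → ℝ) (u : E.domain) : ℝ :=
  E.form u u + ∫ x, V x * (u : Lp ℝ 2 μ) x ^ 2 ∂μ

/-- `Y(U) = inf {ℰ_V(u) : u ∈ 𝒟(ℰ_V), ‖u‖_{2ν/(ν-2)} = 1, supp u ⊆ U} ∈ [-∞, ∞]`, where `𝒟(ℰ_V)`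
consists of the `u ∈ 𝒟(ℰ)` such that `V u²` is integrable. -/
def yamabeInv (E : DirichletForm μ) (ν : ℝ) (V : M → ℝ) (U : Set M) : EReal :=
  ⨅ u ∈ {u : E.domain | Integrable (fun x => V x * (u : Lp ℝ 2 μ) x ^ 2) μ ∧
      eLpNorm (u : Lp ℝ 2 μ) (sobolevExponent ν) μ = 1 ∧
      essSupport μ (u : Lp ℝ 2 μ) ⊆ U},
    (E.schrodinger V u : EReal)

/-- `W` is infinitesimally form bounded: for all `ε > 0` there is `c` such that
`∫ W v² dμ ≤ ε ℰ(v) + c ∫ v² dμ` for all `v ∈ 𝒟(ℰ)`. -/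
def InfFormBounded (E : DirichletForm μ) (W : M → ℝ) : Prop :=
  ∀ ε : ℝ, 0 < ε → ∃ c : ℝ, ∀ v : E.domain,
    Integrable (fun x => W x * (v : Lp ℝ 2 μ) x ^ 2) μ ∧
    ∫ x, W x * (v : Lp ℝ 2 μ) x ^ 2 ∂μ ≤
      ε * E.form v v + c * ∫ x, (v : Lp ℝ 2 μ) x ^ 2 ∂μ

end DirichletForm

end

/-!
Writing `α⟪f - αG_α f, g⟫` for the approximating forms of the resolvent `G_α`, positivity of `αG_α`
makes them nonpositive on every kernel `∑ fᵢ(x) gᵢ(y) ≥ 0` which vanishes on the diagonal. As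
`α → ∞`, kernels such as `∑ cᵢ (uᵢ(x) - uᵢ(y))² - (g(x) - g(y))²` yield a contraction principle for
the form and for the energy measures. Applied to functions `uᵢ` with `dγ(uᵢ, uᵢ) ≤ dμ`, it provides
cutoffs supported in balls, and after normalization a partition `∑ ηᵢ² = 1` with bounded energy
densities. Since `‖v‖_q² ≤ ∑ ‖ηᵢ v‖_q²` for `q ≥ 2` and
`∑ ℰ(ηᵢ v) ≤ ℰ(v) + C‖v‖²`, the local Sobolev inequalities add up to a global one with the same
constant `A`.

At a point which is not an atom, Hölder's inequality bounds `‖v‖²` by an arbitrarily small multiple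
of `‖v‖_q²` for `v` supported in small balls. There the term `B‖v‖²` and, by form boundedness, the
potential term are negligible, so the local constant is `1 / S` and `Y` has the limit of `S`.
-/

noncomputable section

open scoped InnerProductSpace TensorProduct

namespace DirichletForm

section Resolvent

variable {M : Type*} [MeasurableSpace M] {μ : Measure M} [IsFiniteMeasure μ]

/-- The domain `𝒟(ℰ)` with the inner product `ℰ(u, v) + α ⟪u, v⟫` for `α = n + 1`. It is a type
synonym because `𝒟(ℰ)`, as a subspace of `L²`, already carries the `L²` norm. -/
def FormSpace (E : DirichletForm μ) (_n : ℕ) : Type _ := E.domain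

instance (E : DirichletForm μ) (n : ℕ) : AddCommGroup (E.FormSpace n) :=
  inferInstanceAs (AddCommGroup E.domain)

instance (E : DirichletForm μ) (n : ℕ) : Module ℝ (E.FormSpace n) :=
  inferInstanceAs (Module ℝ E.domain)

/-- The identification of `𝒟(ℰ)` with its copy normed by the form. -/
def toFormSpace (E : DirichletForm μ) (n : ℕ) : E.domain ≃ₗ[ℝ] E.FormSpace n :=
  LinearEquiv.refl ℝ E.domain

/-- The inner product `ℰ(u, v) + (n + 1) ⟪u, v⟫` on the form space. -/
abbrev formSpaceCore (E : DirichletForm μ) (n : ℕ) : InnerProductSpace.Core ℝ (E.FormSpace n) where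
  inner u v := E.form ((E.toFormSpace n).symm u) ((E.toFormSpace n).symm v) +
    (n + 1) * ⟪((E.toFormSpace n).symm u : Lp ℝ 2 μ), (E.toFormSpace n).symm v⟫_ℝ
  conj_inner_symm u v := by rw [conj_trivial, E.symm, real_inner_comm]
  re_inner_nonneg u := add_nonneg (E.nonneg _) (mul_nonneg (by positivity) real_inner_self_nonneg)
  add_left u v w := by
    simp only [map_add, LinearMap.add_apply, Submodule.coe_add, inner_add_left]
    ring
  smul_left u v c := by
    simp only [map_smul, LinearMap.smul_apply, Submodule.coe_smul, real_inner_smul_left,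
      smul_eq_mul, conj_trivial]
    ring
  definite u hu := by
    rw [real_inner_self_eq_norm_sq] at hu
    have hnorm := ((add_eq_zero_iff_of_nonneg (E.nonneg _) (by positivity)).1 hu).2
    rw [← (E.toFormSpace n).symm.map_eq_zero_iff]
    simpa [n.cast_add_one_ne_zero] using hnorm

instance (E : DirichletForm μ) (n : ℕ) : NormedAddCommGroup (E.FormSpace n) :=
  (E.formSpaceCore n).toNormedAddCommGroup

instance (E : DirichletForm μ) (n : ℕ) : InnerProductSpace ℝ (E.FormSpace n) :=
  InnerProductSpace.ofCore (E.formSpaceCore n).toCore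

theorem inner_toFormSpace (E : DirichletForm μ) (n : ℕ) (u v : E.domain) :
    ⟪E.toFormSpace n u, E.toFormSpace n v⟫_ℝ =
      E.form u v + (n + 1) * ⟪(u : Lp ℝ 2 μ), v⟫_ℝ := rfl

theorem norm_toFormSpace_sq (E : DirichletForm μ) (n : ℕ) (u : E.domain) :
    ‖E.toFormSpace n u‖ ^ 2 = E.form u u + (n + 1) * ‖(u : Lp ℝ 2 μ)‖ ^ 2 := by
  rw [← real_inner_self_eq_norm_sq, inner_toFormSpace, real_inner_self_eq_norm_sq]

theorem form_add_norm_sq_le (E : DirichletForm μ) (n : ℕ) (u : E.domain) :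
    E.form u u + ‖(u : Lp ℝ 2 μ)‖ ^ 2 ≤ ‖E.toFormSpace n u‖ ^ 2 := by
  rw [norm_toFormSpace_sq]
  nlinarith [mul_nonneg n.cast_nonneg (sq_nonneg ‖(u : Lp ℝ 2 μ)‖)]

theorem norm_toFormSpace_sq_le (E : DirichletForm μ) (n : ℕ) (u : E.domain) :
    ‖E.toFormSpace n u‖ ^ 2 ≤ (n + 1) * (E.form u u + ‖(u : Lp ℝ 2 μ)‖ ^ 2) := by
  rw [norm_toFormSpace_sq]
  nlinarith [mul_nonneg n.cast_nonneg (E.nonneg u)]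

instance (E : DirichletForm μ) (n : ℕ) : CompleteSpace (E.FormSpace n) := by
  refine Metric.complete_of_cauchySeq_tendsto fun u hu => ?_
  let w (k : ℕ) : E.domain := (E.toFormSpace n).symm (u k)
  obtain ⟨v, hv⟩ := E.closed w fun ε hε => by
    obtain ⟨N, hN⟩ := Metric.cauchySeq_iff.1 hu (√ε) (Real.sqrt_pos.2 hε)
    refine ⟨N, fun k hk l hl => (E.form_add_norm_sq_le n _).trans_lt ?_⟩
    rw [← Real.lt_sqrt (norm_nonneg _)]
    simpa [w, dist_eq_norm] using hN k hk l hl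
  refine ⟨E.toFormSpace n v, tendsto_iff_norm_sub_tendsto_zero.2 ?_⟩
  have hsq : Tendsto (fun k => ‖u k - E.toFormSpace n v‖ ^ 2) atTop (𝓝 0) :=
    squeeze_zero (fun _ => sq_nonneg _)
      (fun k => by simpa [w] using E.norm_toFormSpace_sq_le n (w k - v))
      (by simpa using hv.const_mul ((n : ℝ) + 1))
  simpa using hsq.sqrt

/-- The inclusion of the form space in `L²`. -/
def formInclusion (E : DirichletForm μ) (n : ℕ) : E.FormSpace n →L[ℝ] Lp ℝ 2 μ :=
  (E.domain.subtype ∘ₗ (E.toFormSpace n).symm.toLinearMap).mkContinuous 1 fun u => by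
    rw [one_mul]
    refine le_of_sq_le_sq ?_ (norm_nonneg _)
    simpa using (le_add_of_nonneg_left (E.nonneg _)).trans
      (E.form_add_norm_sq_le n ((E.toFormSpace n).symm u))

@[simp]
theorem formInclusion_toFormSpace (E : DirichletForm μ) (n : ℕ) (u : E.domain) :
    E.formInclusion n (E.toFormSpace n u) = u := rfl

/-- The resolvent operator `α G_α` of the form for `α = n + 1`. Up to the factor `α`, it is the
adjoint of the inclusion of the form space in `L²`. -/
def approx (E : DirichletForm μ) (n : ℕ) : Lp ℝ 2 μ →ₗ[ℝ] E.domain :=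
  (E.toFormSpace n).symm.toLinearMap ∘ₗ
    (((n : ℝ) + 1) • (E.formInclusion n).adjoint).toLinearMap

theorem form_approx (E : DirichletForm μ) (n : ℕ) (f : Lp ℝ 2 μ) (w : E.domain) :
    E.form (E.approx n f) w = (n + 1) * ⟪f - E.approx n f, w⟫_ℝ := by
  have hadj : ⟪E.toFormSpace n (E.approx n f), E.toFormSpace n w⟫_ℝ =
      (n + 1) * ⟪f, (w : Lp ℝ 2 μ)⟫_ℝ := by
    simp [approx, real_inner_smul_left, ContinuousLinearMap.adjoint_inner_left]
  rw [inner_toFormSpace] at hadj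
  rw [inner_sub_left]
  linarith

theorem continuous_approx (E : DirichletForm μ) (n : ℕ) :
    Continuous fun f => (E.approx n f : Lp ℝ 2 μ) :=
  ((E.formInclusion n).comp (((n : ℝ) + 1) • (E.formInclusion n).adjoint)).continuous

/-- The approximating form `α ⟪f - α G_α f, g⟫` for `α = n + 1`. -/
def approxForm (E : DirichletForm μ) (n : ℕ) : LinearMap.BilinForm ℝ (Lp ℝ 2 μ) :=
  ((n : ℝ) + 1) • (innerₗ (Lp ℝ 2 μ) ∘ₗ (LinearMap.id - E.domain.subtype ∘ₗ E.approx n))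

theorem approxForm_apply (E : DirichletForm μ) (n : ℕ) (f g : Lp ℝ 2 μ) :
    E.approxForm n f g = (n + 1) * ⟪f - E.approx n f, g⟫_ℝ := rfl

theorem approxForm_coe (E : DirichletForm μ) (n : ℕ) (f : Lp ℝ 2 μ) (w : E.domain) :
    E.approxForm n f w = E.form (E.approx n f) w := by
  rw [form_approx, approxForm_apply]

theorem form_add_norm_sub_sq_eq (E : DirichletForm μ) (n : ℕ) (f : Lp ℝ 2 μ) (h : E.domain) :
    E.form h h + (n + 1) * ‖(h : Lp ℝ 2 μ) - f‖ ^ 2 =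
      E.approxForm n f f + ‖E.toFormSpace n (h - E.approx n f)‖ ^ 2 := by
  have happrox := E.form_approx n f (E.approx n f)
  have hcross := E.form_approx n f h
  rw [inner_sub_left] at happrox hcross
  rw [approxForm_apply, norm_toFormSpace_sq, Submodule.coe_sub, norm_sub_sq_real,
    norm_sub_sq_real, inner_sub_left]
  rw [real_inner_self_eq_norm_sq] at happrox ⊢
  rw [real_inner_comm (h : Lp ℝ 2 μ) (E.approx n f)] at hcross
  simp only [map_sub, LinearMap.sub_apply, E.symm h, real_inner_comm f] at happrox hcross ⊢
  linarith

theorem approxForm_self (E : DirichletForm μ) (n : ℕ) (f : Lp ℝ 2 μ) :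
    E.approxForm n f f = E.form (E.approx n f) (E.approx n f)
      + (n + 1) * ‖(E.approx n f : Lp ℝ 2 μ) - f‖ ^ 2 := by
  simpa using (E.form_add_norm_sub_sq_eq n f (E.approx n f)).symm

theorem approxForm_self_le (E : DirichletForm μ) (n : ℕ) (u : E.domain) :
    E.approxForm n u u ≤ E.form u u := by
  have heq := E.form_add_norm_sub_sq_eq n u u
  rw [sub_self, norm_zero, zero_pow two_ne_zero, mul_zero, add_zero] at heq
  exact heq ▸ le_add_of_nonneg_right (sq_nonneg _)

theorem approx_nonneg (E : DirichletForm μ) (n : ℕ) {f : Lp ℝ 2 μ} (hf : 0 ≤ f) :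
    0 ≤ (E.approx n f : Lp ℝ 2 μ) := by
  obtain ⟨habs, hform⟩ := E.markov_abs (E.approx n f)
  have hnorm : ‖|(E.approx n f : Lp ℝ 2 μ)| - f‖ ≤ ‖(E.approx n f : Lp ℝ 2 μ) - f‖ := by
    refine norm_le_norm_of_abs_le_abs ?_
    simpa only [abs_of_nonneg hf] using abs_abs_sub_abs_le (E.approx n f : Lp ℝ 2 μ) f
  -- `|αG_α f|` also minimises `h ↦ ℰ(h) + α‖h - f‖²`, so it is `αG_α f`.
  have hmin := E.form_add_norm_sub_sq_eq n f ⟨_, habs⟩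
  have hle : E.form ⟨_, habs⟩ ⟨_, habs⟩ + (n + 1) * ‖|(E.approx n f : Lp ℝ 2 μ)| - f‖ ^ 2 ≤
      E.approxForm n f f := by
    rw [approxForm_self]
    gcongr
  have hzero : ‖E.toFormSpace n (⟨_, habs⟩ - E.approx n f)‖ ^ 2 = 0 :=
    le_antisymm (by linarith) (sq_nonneg _)
  rw [sq_eq_zero_iff, norm_eq_zero, LinearEquiv.map_eq_zero_iff, sub_eq_zero] at hzero
  exact congrArg Subtype.val hzero ▸ abs_nonneg _

theorem form_approx_sub_le (E : DirichletForm μ) (f : Lp ℝ 2 μ) {k n : ℕ} (hkn : k ≤ n) :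
    E.form (E.approx n f - E.approx k f) (E.approx n f - E.approx k f) ≤
      E.form (E.approx n f) (E.approx n f) - E.form (E.approx k f) (E.approx k f) := by
  rcases hkn.eq_or_lt with rfl | hlt
  · simp
  have hk := E.form_add_norm_sub_sq_eq k f (E.approx n f)
  have hn := E.form_add_norm_sub_sq_eq n f (E.approx k f)
  rw [approxForm_self] at hk hn
  have hkform := E.form_add_norm_sq_le k (E.approx n f - E.approx k f)
  have hlt' : (k : ℝ) < n := by exact_mod_cast hlt
  have hdist : ‖(E.approx n f : Lp ℝ 2 μ) - f‖ ^ 2 ≤ ‖(E.approx k f : Lp ℝ 2 μ) - f‖ ^ 2 := by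
    nlinarith [sq_nonneg ‖E.toFormSpace n (E.approx k f - E.approx n f)‖,
      sq_nonneg ‖E.toFormSpace k (E.approx n f - E.approx k f)‖]
  nlinarith [sq_nonneg ‖((E.approx n f - E.approx k f : E.domain) : Lp ℝ 2 μ)‖,
    (k.cast_nonneg : (0 : ℝ) ≤ k)]

theorem norm_approx_sub_sq_le (E : DirichletForm μ) {n : ℕ} {f : Lp ℝ 2 μ} {C : ℝ}
    (hC : E.approxForm n f f ≤ C) :
    ‖(E.approx n f : Lp ℝ 2 μ) - f‖ ^ 2 ≤ C * (1 / ((n : ℝ) + 1)) := by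
  rw [approxForm_self] at hC
  rw [mul_one_div, le_div_iff₀ n.cast_add_one_pos]
  linarith [E.nonneg (E.approx n f)]

theorem cauchySeq_approx (E : DirichletForm μ) {f : Lp ℝ 2 μ} {C : ℝ}
    (hC : ∀ n, E.approxForm n f f ≤ C) :
    CauchySeq fun n => E.toFormSpace 0 (E.approx n f) := by
  let e (n : ℕ) : ℝ := E.form (E.approx n f) (E.approx n f)
  have hmono : Monotone e := fun k n hkn =>
    sub_nonneg.1 ((E.nonneg _).trans (E.form_approx_sub_le f hkn))
  have he (n : ℕ) : e n ≤ C :=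
    (le_add_of_nonneg_right (by positivity)).trans ((E.approxForm_self n f).ge.trans (hC n))
  have hbdd : BddAbove (Set.range e) := ⟨C, Set.forall_mem_range.2 he⟩
  have hlim := ((tendsto_const_nhds (x := ⨆ n, e n)).sub (tendsto_atTop_ciSup hmono hbdd)).add
    ((tendsto_one_div_add_atTop_nhds_zero_nat (𝕜 := ℝ)).const_mul (4 * C))
  rw [sub_self, mul_zero, add_zero] at hlim
  refine cauchySeq_of_le_tendsto_0' _ (fun k n hkn => ?_) (Real.sqrt_zero ▸ hlim.sqrt)
  have hC0 : 0 ≤ C := (E.nonneg _).trans (he 0)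
  have hk := E.norm_approx_sub_sq_le (hC k)
  have hn := (E.norm_approx_sub_sq_le (hC n)).trans
    (mul_le_mul_of_nonneg_left (Nat.one_div_le_one_div hkn) hC0)
  have hpar := parallelogram_law_with_norm ℝ ((E.approx n f : Lp ℝ 2 μ) - f) (E.approx k f - f)
  rw [sub_sub_sub_cancel_right] at hpar
  rw [dist_comm, dist_eq_norm, ← map_sub]
  refine Real.le_sqrt_of_sq_le ?_
  rw [norm_toFormSpace_sq, Submodule.coe_sub, Nat.cast_zero, zero_add, one_mul]
  have hform := E.form_approx_sub_le f hkn
  have hsup : e n ≤ ⨆ n, e n := le_ciSup hbdd n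
  nlinarith [mul_self_nonneg
    ‖((E.approx n f : Lp ℝ 2 μ) - f) + ((E.approx k f : Lp ℝ 2 μ) - f)‖]

theorem exists_tendsto_approx (E : DirichletForm μ) {f : Lp ℝ 2 μ} {C : ℝ}
    (hC : ∀ n, E.approxForm n f f ≤ C) :
    ∃ v : E.domain, (v : Lp ℝ 2 μ) = f ∧
      Tendsto (fun n => E.toFormSpace 0 (E.approx n f)) atTop (𝓝 (E.toFormSpace 0 v)) := by
  obtain ⟨v, hv⟩ := cauchySeq_tendsto_of_complete (E.cauchySeq_approx hC)
  refine ⟨(E.toFormSpace 0).symm v, ?_, by simpa using hv⟩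
  have hsq : Tendsto (fun n => ‖(E.approx n f : Lp ℝ 2 μ) - f‖ ^ 2) atTop (𝓝 0) :=
    squeeze_zero (fun _ => sq_nonneg _) (fun n => E.norm_approx_sub_sq_le (hC n))
      (by simpa using tendsto_one_div_add_atTop_nhds_zero_nat.const_mul C)
  exact tendsto_nhds_unique (((E.formInclusion 0).continuous.tendsto v).comp hv)
    (tendsto_iff_norm_sub_tendsto_zero.2 (by simpa using hsq.sqrt))

theorem tendsto_form (E : DirichletForm μ) {ι : Type*} {l : Filter ι} {u v : ι → E.domain}
    {u₀ v₀ : E.domain}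
    (hu : Tendsto (fun i => E.toFormSpace 0 (u i)) l (𝓝 (E.toFormSpace 0 u₀)))
    (hv : Tendsto (fun i => E.toFormSpace 0 (v i)) l (𝓝 (E.toFormSpace 0 v₀))) :
    Tendsto (fun i => E.form (u i) (v i)) l (𝓝 (E.form u₀ v₀)) := by
  have hform (a b : E.domain) : E.form a b =
      ⟪E.toFormSpace 0 a, E.toFormSpace 0 b⟫_ℝ -
        ⟪E.formInclusion 0 (E.toFormSpace 0 a), E.formInclusion 0 (E.toFormSpace 0 b)⟫_ℝ := by
    simp [inner_toFormSpace]
  simp only [hform]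
  exact (hu.inner hv).sub ((((E.formInclusion 0).continuous.tendsto _).comp hu).inner
    (((E.formInclusion 0).continuous.tendsto _).comp hv))

theorem tendsto_approxForm (E : DirichletForm μ) (u v : E.domain) :
    Tendsto (fun n => E.approxForm n u v) atTop (𝓝 (E.form u v)) := by
  obtain ⟨u', hu', hlim⟩ := E.exists_tendsto_approx fun n => E.approxForm_self_le n u
  obtain rfl : u' = u := Subtype.ext hu'
  simpa only [approxForm_coe] using E.tendsto_form hlim tendsto_const_nhds

theorem approxForm_comm (E : DirichletForm μ) (n : ℕ) (f g : Lp ℝ 2 μ) :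
    E.approxForm n f g = E.approxForm n g f := by
  have hform (f g : Lp ℝ 2 μ) : E.form (E.approx n f) (E.approx n g) =
      (n + 1) * (⟪(E.approx n g : Lp ℝ 2 μ), f⟫_ℝ -
        ⟪(E.approx n f : Lp ℝ 2 μ), E.approx n g⟫_ℝ) := by
    rw [form_approx, inner_sub_left, real_inner_comm f]
  have hsymm := (hform f g).symm.trans ((E.symm _ _).trans (hform g f))
  rw [approxForm_apply, approxForm_apply, inner_sub_left, inner_sub_left, real_inner_comm f g]
  rw [real_inner_comm (E.approx n f : Lp ℝ 2 μ) (E.approx n g)] at hsymm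
  linarith

end Resolvent

end DirichletForm

theorem inner_Lp_nonneg {α : Type*} [MeasurableSpace α] {μ : Measure α} {f g : Lp ℝ 2 μ}
    (hf : 0 ≤ f) (hg : 0 ≤ g) : 0 ≤ ⟪f, g⟫_ℝ := by
  rw [L2.inner_def]
  refine integral_nonneg_of_ae ?_
  filter_upwards [(Lp.coeFn_nonneg f).2 hf, (Lp.coeFn_nonneg g).2 hg] with x hfx hgx
  simpa using mul_nonneg hgx hfx

section Kernel

variable {M : Type*} [TopologicalSpace M]

/-- The value at `(x, y)` of the kernel `∑ fᵢ(x) gᵢ(y)` represented by an element of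
`C⁰(M) ⊗ C⁰(M)`. -/
def evalKernel (x y : M) : C(M, ℝ) ⊗[ℝ] C(M, ℝ) →ₐ[ℝ] ℝ :=
  Algebra.TensorProduct.productMap (ContinuousMap.evalAlgHom ℝ ℝ x)
    (ContinuousMap.evalAlgHom ℝ ℝ y)

@[simp]
theorem evalKernel_tmul (x y : M) (f g : C(M, ℝ)) : evalKernel x y (f ⊗ₜ g) = f x * g y := by
  simp [evalKernel]

/-- The kernel `f(x) - f(y)`. -/
def diffKernel (f : C(M, ℝ)) : C(M, ℝ) ⊗[ℝ] C(M, ℝ) := f ⊗ₜ 1 - 1 ⊗ₜ f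

@[simp]
theorem evalKernel_diffKernel (x y : M) (f : C(M, ℝ)) :
    evalKernel x y (diffKernel f) = f x - f y := by
  simp [diffKernel]

theorem diffKernel_sq (f : C(M, ℝ)) :
    diffKernel f ^ 2 = (f * f) ⊗ₜ 1 - (2 : ℝ) • (f ⊗ₜ f) + 1 ⊗ₜ (f * f) := by
  simp only [diffKernel, pow_two, sub_mul, mul_sub, Algebra.TensorProduct.tmul_mul_tmul, mul_one,
    one_mul]
  module

theorem exists_norm_sub_sum_smul_lt [CompactSpace M] [T2Space M] {X : Type*} [NormedAddCommGroup X]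
    [NormedSpace ℝ X] (F : C(M, X)) {ε : ℝ} (hε : 0 < ε) :
    ∃ (t : Finset M) (ρ : t → C(M, ℝ)), (∀ j, 0 ≤ ρ j) ∧
      ∀ x, ‖F x - ∑ j : t, ρ j x • F j‖ < ε := by
  let U (x : M) : Set M := F ⁻¹' Metric.ball (F x) ε
  have hU (x : M) : IsOpen (U x) := Metric.isOpen_ball.preimage F.continuous
  obtain ⟨t, ht⟩ := isCompact_univ.elim_finite_subcover U hU
    fun x _ => Set.mem_iUnion.2 ⟨x, Metric.mem_ball_self hε⟩
  obtain ⟨ρ, hρ⟩ := PartitionOfUnity.exists_isSubordinate isClosed_univ (fun j : t => U j)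
    (fun j => hU j) (by rwa [Set.iUnion_subtype])
  refine ⟨t, fun j => ρ j, ρ.nonneg, fun x => ?_⟩
  have hmem := ρ.finsum_smul_mem_convex (g := fun j _ => F j) (Set.mem_univ x)
    (fun j hj => Metric.mem_ball'.1 (hρ j (subset_tsupport _ hj))) (convex_ball (F x) ε)
  rwa [finsum_eq_sum_of_fintype, Metric.mem_ball, dist_comm, dist_eq_norm] at hmem

theorem exists_dist_sum_smul_lt [CompactSpace M] [T2Space M] {ι : Type*} [Fintype ι]
    (f : ι → C(M, ℝ)) {ε : ℝ} (hε : 0 < ε) :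
    ∃ (t : Finset M) (ρ : t → C(M, ℝ)), (∀ j, 0 ≤ ρ j) ∧
      Dist.dist f (fun i => ∑ j : t, f i j • ρ j) < ε := by
  obtain ⟨t, ρ, hρ, hlt⟩ := exists_norm_sub_sum_smul_lt (ContinuousMap.pi f) hε
  refine ⟨t, ρ, hρ, (dist_pi_lt_iff hε).2 fun i => (ContinuousMap.dist_lt_iff hε).2 fun x => ?_⟩
  simpa [Real.dist_eq, mul_comm] using (norm_le_pi_norm _ i).trans_lt (hlt x)

theorem sum_bilin_sum_smul_nonneg (β : C(M, ℝ) →L[ℝ] C(M, ℝ) →L[ℝ] ℝ)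
    (hβ : ∀ f g : C(M, ℝ), 0 ≤ f → 0 ≤ g → 0 ≤ β f g) {ι : Type*} [Fintype ι]
    {f g : ι → C(M, ℝ)} (h : ∀ x y, 0 ≤ ∑ i, f i x * g i y) {κ : Type*} [Fintype κ] (p : κ → M)
    {ρ : κ → C(M, ℝ)} (hρ : ∀ j, 0 ≤ ρ j) :
    0 ≤ ∑ i, β (∑ j, f i (p j) • ρ j) (∑ k, g i (p k) • ρ k) := by
  have hsum : ∑ i, β (∑ j, f i (p j) • ρ j) (∑ k, g i (p k) • ρ k) =
      ∑ k, ∑ j, (∑ i, f i (p j) * g i (p k)) * β (ρ j) (ρ k) := by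
    simp only [map_sum, map_smul, sum_apply, smul_apply, smul_eq_mul, Finset.sum_mul,
      Finset.mul_sum, mul_assoc, mul_left_comm]
    rw [← Finset.sum_comm_cycle]
  rw [hsum]
  exact Finset.sum_nonneg fun k _ => Finset.sum_nonneg fun j _ =>
    mul_nonneg (h _ _) (hβ _ _ (hρ j) (hρ k))

variable [CompactSpace M]

theorem sum_bilin_nonneg [T2Space M] (β : C(M, ℝ) →L[ℝ] C(M, ℝ) →L[ℝ] ℝ)
    (hβ : ∀ f g : C(M, ℝ), 0 ≤ f → 0 ≤ g → 0 ≤ β f g) {ι : Type*} [Fintype ι]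
    (f g : ι → C(M, ℝ)) (h : ∀ x y, 0 ≤ ∑ i, f i x * g i y) : 0 ≤ ∑ i, β (f i) (g i) := by
  let S : Set (ι ⊕ ι → C(M, ℝ)) := {p | 0 ≤ ∑ i, β (p (Sum.inl i)) (p (Sum.inr i))}
  have hS : IsClosed S := isClosed_le continuous_const (by fun_prop)
  suffices Sum.elim f g ∈ closure S from hS.closure_subset this
  refine Metric.mem_closure_iff.2 fun ε hε => ?_
  obtain ⟨t, ρ, hρ, hdist⟩ := exists_dist_sum_smul_lt (Sum.elim f g) hε
  exact ⟨_, sum_bilin_sum_smul_nonneg β hβ h _ hρ, hdist⟩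

variable [MeasurableSpace M] [BorelSpace M] {μ : Measure M} [IsFiniteMeasure μ]

theorem integrable_of_compactSpace (f : C(M, ℝ)) : Integrable f μ :=
  f.continuous.integrable_of_hasCompactSupport (HasCompactSupport.of_compactSpace f)

theorem toLp_nonneg {f : C(M, ℝ)} (hf : 0 ≤ f) : 0 ≤ ContinuousMap.toLp 2 μ ℝ f := by
  rw [← Lp.coeFn_nonneg]
  filter_upwards [ContinuousMap.coeFn_toLp (p := 2) (𝕜 := ℝ) μ f] with x hx
  rw [hx]
  exact hf x

theorem inner_toLp (f g : C(M, ℝ)) :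
    ⟪ContinuousMap.toLp 2 μ ℝ f, ContinuousMap.toLp 2 μ ℝ g⟫_ℝ = ∫ x, f x * g x ∂μ := by
  simp [ContinuousMap.inner_toLp, mul_comm]

namespace DirichletForm

/-- The approximating form as a linear functional on kernels: it maps the kernel `f(x) g(y)` to
`α ⟪f - α G_α f, g⟫`. -/
def kernelForm (E : DirichletForm μ) (n : ℕ) : C(M, ℝ) ⊗[ℝ] C(M, ℝ) →ₗ[ℝ] ℝ :=
  TensorProduct.lift ((E.approxForm n).compl₁₂ (ContinuousMap.toLp 2 μ ℝ).toLinearMap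
    (ContinuousMap.toLp 2 μ ℝ).toLinearMap)

@[simp]
theorem kernelForm_tmul (E : DirichletForm μ) (n : ℕ) (f g : C(M, ℝ)) :
    E.kernelForm n (f ⊗ₜ g) =
      E.approxForm n (ContinuousMap.toLp 2 μ ℝ f) (ContinuousMap.toLp 2 μ ℝ g) := rfl

theorem sum_inner_approx_nonneg [T2Space M] (E : DirichletForm μ) (n : ℕ) {ι : Type*} [Fintype ι]
    (f g : ι → C(M, ℝ)) (h : ∀ x y, 0 ≤ ∑ i, f i x * g i y) :
    0 ≤ ∑ i, ⟪(E.approx n (ContinuousMap.toLp 2 μ ℝ (f i)) : Lp ℝ 2 μ),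
      ContinuousMap.toLp 2 μ ℝ (g i)⟫_ℝ :=
  let R : Lp ℝ 2 μ →L[ℝ] Lp ℝ 2 μ := ⟨E.domain.subtype ∘ₗ E.approx n, E.continuous_approx n⟩
  let β : C(M, ℝ) →L[ℝ] C(M, ℝ) →L[ℝ] ℝ :=
    (innerSL ℝ).bilinearComp (R ∘L ContinuousMap.toLp 2 μ ℝ) (ContinuousMap.toLp 2 μ ℝ)
  sum_bilin_nonneg β (fun _ _ hf hg => inner_Lp_nonneg
    (E.approx_nonneg n (toLp_nonneg hf)) (toLp_nonneg hg)) f g h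

theorem kernelForm_nonpos [T2Space M] (E : DirichletForm μ) (n : ℕ)
    (t : C(M, ℝ) ⊗[ℝ] C(M, ℝ)) (hpos : ∀ x y, 0 ≤ evalKernel x y t)
    (hdiag : ∀ x, evalKernel x x t = 0) : E.kernelForm n t ≤ 0 := by
  obtain ⟨k, f, g, rfl⟩ := TensorProduct.exists_sum_tmul_eq t
  simp only [map_sum, evalKernel_tmul, kernelForm_tmul] at *
  have hzero : ∑ i, ⟪ContinuousMap.toLp 2 μ ℝ (f i), ContinuousMap.toLp 2 μ ℝ (g i)⟫_ℝ = 0 := by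
    simp only [inner_toLp]
    rw [← integral_finsetSum _ fun i _ => ?_]
    · simp [hdiag]
    · exact integrable_of_compactSpace (f i * g i)
  simp only [approxForm_apply, inner_sub_left, ← Finset.mul_sum, Finset.sum_sub_distrib, hzero,
    zero_sub]
  exact mul_nonpos_of_nonneg_of_nonpos (by positivity)
    (neg_nonpos.2 (E.sum_inner_approx_nonneg n f g hpos))

end DirichletForm

end Kernel

theorem mul_sub_mul_sq_le {M : Type*} [TopologicalSpace M] [CompactSpace M] (f g : C(M, ℝ))
    (x y : M) :
    (f x * g x - f y * g y) ^ 2 ≤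
      2 * ‖g‖ ^ 2 * (f x - f y) ^ 2 + 2 * ‖f‖ ^ 2 * (g x - g y) ^ 2 := by
  have hg : g x ^ 2 ≤ ‖g‖ ^ 2 := sq_le_sq.2 (by simpa using g.norm_coe_le_norm x)
  have hf : f y ^ 2 ≤ ‖f‖ ^ 2 := sq_le_sq.2 (by simpa using f.norm_coe_le_norm y)
  calc (f x * g x - f y * g y) ^ 2 = (g x * (f x - f y) + f y * (g x - g y)) ^ 2 := by ring
    _ ≤ 2 * ((g x * (f x - f y)) ^ 2 + (f y * (g x - g y)) ^ 2) := add_sq_le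
    _ = 2 * g x ^ 2 * (f x - f y) ^ 2 + 2 * f y ^ 2 * (g x - g y) ^ 2 := by ring
    _ ≤ _ := by gcongr

namespace DirichletForm

section Energy

variable {M : Type*} [TopologicalSpace M] [CompactSpace M] [MeasurableSpace M] [BorelSpace M]
  {μ : Measure M} [IsFiniteMeasure μ] {E : DirichletForm μ}

/-- Conservativeness: the constant function `1` lies in `𝒟(ℰ)` and `ℰ(1, w) = 0` for all `w`. On a
compact space this allows for nonlocal (jump) forms besides the strongly local ones. -/
def IsConservative (E : DirichletForm μ) : Prop :=
  ∃ h : (1 : C(M, ℝ)) ∈ E.contDomain, ∀ w, E.form ⟨_, h⟩ w = 0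

theorem inf_const_toLp_of_one_le {f : C(M, ℝ)} (hf : ∀ x, 1 ≤ f x) :
    ContinuousMap.toLp 2 μ ℝ f ⊓ Lp.const 2 μ (1 : ℝ) = ContinuousMap.toLp 2 μ ℝ 1 := by
  apply Lp.ext
  filter_upwards [Lp.coeFn_inf (ContinuousMap.toLp 2 μ ℝ f) (Lp.const 2 μ (1 : ℝ)),
    ContinuousMap.coeFn_toLp (p := 2) (𝕜 := ℝ) μ f,
    ContinuousMap.coeFn_toLp (p := 2) (𝕜 := ℝ) μ (1 : C(M, ℝ)),
    Lp.coeFn_const (p := 2) (μ := μ) (1 : ℝ)] with x hinf hfx hone hconst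
  rw [hinf, Pi.inf_apply, hfx, hone, hconst]
  simpa using hf x

theorem one_mem_contDomain (hdense : Dense E.contDomain) : (1 : C(M, ℝ)) ∈ E.contDomain := by
  obtain ⟨f, hf, hdist⟩ := hdense.exists_dist_lt (.const M 2) one_pos
  have hfone (x : M) : 1 ≤ f x := by
    have hx := (ContinuousMap.dist_apply_le_dist x).trans_lt hdist
    rw [Real.dist_eq, abs_lt, ContinuousMap.const_apply] at hx
    linarith
  obtain ⟨h, -⟩ := E.markov_inf ⟨_, hf⟩ (toLp_nonneg fun x => zero_le_one.trans (hfone x))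
  rwa [inf_const_toLp_of_one_le hfone] at h

theorem IsStronglyLocal.isConservative (hloc : E.IsStronglyLocal) (hdense : Dense E.contDomain) :
    E.IsConservative := by
  refine ⟨one_mem_contDomain hdense,
    fun w => hloc _ _ ⟨Set.univ, isOpen_univ, Set.subset_univ _, 1, ?_⟩⟩
  filter_upwards [ContinuousMap.coeFn_toLp (p := 2) (𝕜 := ℝ) μ (1 : C(M, ℝ))] with x hx _
  simpa using hx

/-- The form `ℰ(f, g)` for continuous functions `f`, `g` of the domain, extended by the junk value
`0` to all continuous functions. -/
def contForm (E : DirichletForm μ) (f g : C(M, ℝ)) : ℝ :=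
  open Classical in
  if h : f ∈ E.contDomain ∧ g ∈ E.contDomain then E.form ⟨_, h.1⟩ ⟨_, h.2⟩ else 0

theorem contForm_eq {f g : C(M, ℝ)} (hf : f ∈ E.contDomain) (hg : g ∈ E.contDomain) :
    E.contForm f g = E.form ⟨_, hf⟩ ⟨_, hg⟩ :=
  dif_pos ⟨hf, hg⟩

theorem contForm_self_nonneg (f : C(M, ℝ)) : 0 ≤ E.contForm f f := by
  unfold contForm
  split_ifs
  · exact E.nonneg _
  · exact le_rfl

theorem tendsto_kernelForm_tmul {f g : C(M, ℝ)} (hf : f ∈ E.contDomain) (hg : g ∈ E.contDomain) :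
    Tendsto (fun n => E.kernelForm n (f ⊗ₜ g)) atTop (𝓝 (E.contForm f g)) := by
  rw [contForm_eq hf hg]
  exact E.tendsto_approxForm ⟨_, hf⟩ ⟨_, hg⟩

theorem kernelForm_tmul_self_le (n : ℕ) {f : C(M, ℝ)} (hf : f ∈ E.contDomain) :
    E.kernelForm n (f ⊗ₜ f) ≤ E.contForm f f := by
  rw [contForm_eq hf hf]
  exact E.approxForm_self_le n ⟨_, hf⟩

theorem kernelForm_tmul_comm (n : ℕ) (f g : C(M, ℝ)) :
    E.kernelForm n (f ⊗ₜ g) = E.kernelForm n (g ⊗ₜ f) :=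
  E.approxForm_comm n _ _

theorem contForm_sum_left {ι : Type*} (s : Finset ι) {f : ι → C(M, ℝ)} {g : C(M, ℝ)}
    (hf : ∀ i, f i ∈ E.contDomain) (hg : g ∈ E.contDomain)
    (hs : ∑ i ∈ s, f i ∈ E.contDomain) :
    E.contForm (∑ i ∈ s, f i) g = ∑ i ∈ s, E.contForm (f i) g := by
  have hlim := tendsto_finsetSum s fun i _ => tendsto_kernelForm_tmul (hf i) hg
  refine tendsto_nhds_unique (tendsto_kernelForm_tmul hs hg) (hlim.congr fun n => ?_)
  rw [TensorProduct.sum_tmul, map_sum]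

theorem kernelForm_tmul_one (hE : E.IsConservative) (n : ℕ) (f : C(M, ℝ)) :
    E.kernelForm n (f ⊗ₜ 1) = 0 := by
  obtain ⟨hone, hform⟩ := hE
  exact (E.approxForm_coe n _ ⟨_, hone⟩).trans ((E.symm _ _).trans (hform _))

theorem kernelForm_mul_diffKernel_sq (hE : E.IsConservative) (n : ℕ) (φ f : C(M, ℝ)) :
    E.kernelForm n ((φ ⊗ₜ 1) * diffKernel f ^ 2) =
      -2 * E.kernelForm n ((φ * f) ⊗ₜ f) + E.kernelForm n (φ ⊗ₜ (f * f)) := by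
  rw [diffKernel_sq, mul_add, mul_sub, mul_smul_comm]
  simp only [Algebra.TensorProduct.tmul_mul_tmul, mul_one, one_mul, map_add, map_sub, map_smul,
    smul_eq_mul, kernelForm_tmul_one hE]
  ring

theorem kernelForm_diffKernel_sq (hE : E.IsConservative) (n : ℕ) (f : C(M, ℝ)) :
    E.kernelForm n (diffKernel f ^ 2) = -2 * E.kernelForm n (f ⊗ₜ f) := by
  have h := kernelForm_mul_diffKernel_sq hE n 1 f
  rwa [← Algebra.TensorProduct.one_def, one_mul, one_mul, kernelForm_tmul_comm n 1,
    kernelForm_tmul_one hE, add_zero] at h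

theorem kernelForm_diffKernel_sq_mul_diffKernel_sq (hE : E.IsConservative) (n : ℕ)
    (η v : C(M, ℝ)) :
    E.kernelForm n (diffKernel η ^ 2 * diffKernel v ^ 2) =
      -4 * E.kernelForm n ((η * η * v) ⊗ₜ v) + 2 * E.kernelForm n ((v * v) ⊗ₜ (η * η)) +
        (4 * E.kernelForm n ((η * v) ⊗ₜ (η * v)) - 4 * E.kernelForm n ((v * v * η) ⊗ₜ η)) := by
  simp only [diffKernel_sq, add_mul, sub_mul, mul_add, mul_sub, mul_smul_comm, smul_mul_assoc,
    Algebra.TensorProduct.tmul_mul_tmul, mul_one, one_mul, map_add, map_sub, map_smul,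
    smul_eq_mul, kernelForm_tmul_comm n 1, kernelForm_tmul_one hE]
  rw [kernelForm_tmul_comm n (η * η) (v * v), kernelForm_tmul_comm n v (η * η * v),
    kernelForm_tmul_comm n η (η * (v * v)), mul_comm η (v * v)]
  ring

/-- The functional `φ ↦ ∫ φ dγ(u, u)` given by the energy measure of `u`. -/
def energy (E : DirichletForm μ) (u φ : C(M, ℝ)) : ℝ :=
  E.contForm (φ * u) u - 1 / 2 * E.contForm φ (u * u)

/-- `u` lies in the domain and `dγ(u, u) ≤ C dμ`, as an inequality of functionals on the
nonnegative functions of `𝒟(ℰ) ∩ C⁰(M)`. -/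
def EnergyBounded (E : DirichletForm μ) (u : C(M, ℝ)) (C : ℝ) : Prop :=
  u ∈ E.contDomain ∧ ∀ φ ∈ E.contDomain, 0 ≤ φ → E.energy u φ ≤ C * ∫ x, φ x ∂μ

theorem EnergyLe.energyBounded {u : C(M, ℝ)} (hu : E.EnergyLe u) : E.EnergyBounded u 1 := by
  obtain ⟨f, -, hf, -, -, hmem, henergy⟩ := hu
  refine ⟨hmem, fun φ hφ hφ0 => ?_⟩
  obtain ⟨hφu, huu, heq⟩ := henergy φ hφ
  rw [energy, contForm_eq hφu hmem, contForm_eq hφ huu, heq, one_mul]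
  refine integral_mono_measure ?_ (ae_of_all _ hφ0) (integrable_of_compactSpace φ)
  calc μ.withDensity f ≤ μ.withDensity 1 := withDensity_mono (ae_of_all _ hf)
    _ = μ := withDensity_one

variable [T2Space M]

theorem mem_contDomain_of_contraction (hE : E.IsConservative) {ι : Type*} [Fintype ι]
    {u : ι → C(M, ℝ)} {c : ι → ℝ} {g : C(M, ℝ)} (hu : ∀ i, u i ∈ E.contDomain) (hc : ∀ i, 0 ≤ c i)
    (hg : ∀ x y, (g x - g y) ^ 2 ≤ ∑ i, c i * (u i x - u i y) ^ 2) : g ∈ E.contDomain := by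
  have hbound (n : ℕ) : E.kernelForm n (g ⊗ₜ g) ≤ ∑ i, c i * E.contForm (u i) (u i) := by
    have hker := E.kernelForm_nonpos n (∑ i, c i • diffKernel (u i) ^ 2 - diffKernel g ^ 2)
      (fun x y => by simpa using hg x y) (fun x => by simp)
    simp only [map_sub, map_sum, map_smul, kernelForm_diffKernel_sq hE, smul_eq_mul,
      mul_left_comm _ (-2 : ℝ), ← Finset.mul_sum] at hker
    have hle : ∑ i, c i * E.kernelForm n (u i ⊗ₜ u i) ≤ ∑ i, c i * E.contForm (u i) (u i) :=
      Finset.sum_le_sum fun i _ => mul_le_mul_of_nonneg_left (kernelForm_tmul_self_le n (hu i))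
        (hc i)
    linarith
  obtain ⟨v, hv, -⟩ := E.exists_tendsto_approx hbound
  exact (hv ▸ v.2 : ContinuousMap.toLp 2 μ ℝ g ∈ E.domain)

theorem mul_mem_contDomain (hE : E.IsConservative) {f g : C(M, ℝ)} (hf : f ∈ E.contDomain)
    (hg : g ∈ E.contDomain) : f * g ∈ E.contDomain :=
  mem_contDomain_of_contraction hE (u := ![f, g]) (c := ![2 * ‖g‖ ^ 2, 2 * ‖f‖ ^ 2])
    (by simp [Fin.forall_fin_two, hf, hg]) (by simp [Fin.forall_fin_two])
    fun x y => by simpa [Fin.sum_univ_two] using mul_sub_mul_sq_le f g x y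

theorem tendsto_kernelForm_mul_diffKernel_sq (hE : E.IsConservative) {u φ : C(M, ℝ)}
    (hu : u ∈ E.contDomain) (hφ : φ ∈ E.contDomain) :
    Tendsto (fun n => E.kernelForm n ((φ ⊗ₜ 1) * diffKernel u ^ 2)) atTop
      (𝓝 (-2 * E.energy u φ)) := by
  have hlim := ((tendsto_kernelForm_tmul (mul_mem_contDomain hE hφ hu) hu).const_mul
    (-2)).add (tendsto_kernelForm_tmul hφ (mul_mem_contDomain hE hu hu))
  simp only [kernelForm_mul_diffKernel_sq hE]
  convert hlim using 2
  rw [energy]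
  ring

theorem energy_le_of_contraction (hE : E.IsConservative) {ι : Type*} [Fintype ι]
    {u : ι → C(M, ℝ)} {c : ι → ℝ} {g φ : C(M, ℝ)} (hu : ∀ i, u i ∈ E.contDomain)
    (hc : ∀ i, 0 ≤ c i) (hg : ∀ x y, (g x - g y) ^ 2 ≤ ∑ i, c i * (u i x - u i y) ^ 2)
    (hφ : φ ∈ E.contDomain) (hφ0 : 0 ≤ φ) :
    E.energy g φ ≤ ∑ i, c i * E.energy (u i) φ := by
  have hgmem := mem_contDomain_of_contraction hE hu hc hg
  have hlim := (tendsto_finsetSum Finset.univ fun i _ =>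
    (tendsto_kernelForm_mul_diffKernel_sq hE (hu i) hφ).const_mul (c i)).sub
      (tendsto_kernelForm_mul_diffKernel_sq hE hgmem hφ)
  have hle := le_of_tendsto' hlim (b := 0) fun n => by
    have hker := E.kernelForm_nonpos n
      ((φ ⊗ₜ 1) * (∑ i, c i • diffKernel (u i) ^ 2 - diffKernel g ^ 2))
      (fun x y => by simpa using mul_nonneg (hφ0 x) (sub_nonneg.2 (hg x y))) (fun x => by simp)
    simpa only [mul_sub, Finset.mul_sum, mul_smul_comm, map_sub, map_sum, map_smul,
      smul_eq_mul] using hker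
  simp only [mul_left_comm _ (-2 : ℝ), ← Finset.mul_sum] at hle
  linarith

theorem EnergyBounded.of_contraction (hE : E.IsConservative) {ι : Type*} [Fintype ι]
    {u : ι → C(M, ℝ)} {c C : ι → ℝ} {g : C(M, ℝ)} (hu : ∀ i, E.EnergyBounded (u i) (C i))
    (hc : ∀ i, 0 ≤ c i) (hg : ∀ x y, (g x - g y) ^ 2 ≤ ∑ i, c i * (u i x - u i y) ^ 2) :
    E.EnergyBounded g (∑ i, c i * C i) := by
  refine ⟨mem_contDomain_of_contraction hE (fun i => (hu i).1) hc hg, fun φ hφ hφ0 => ?_⟩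
  refine (energy_le_of_contraction hE (fun i => (hu i).1) hc hg hφ hφ0).trans ?_
  simp only [Finset.sum_mul, mul_assoc]
  exact Finset.sum_le_sum fun i _ => mul_le_mul_of_nonneg_left ((hu i).2 φ hφ hφ0) (hc i)

theorem contForm_mul_self_le (hE : E.IsConservative) {η v : C(M, ℝ)} (hη : η ∈ E.contDomain)
    (hv : v ∈ E.contDomain) :
    E.contForm (η * v) (η * v) ≤ E.contForm (η * η * v) v + E.energy η (v * v) := by
  have hηη := mul_mem_contDomain hE hη hη
  have hvv := mul_mem_contDomain hE hv hv
  have hηv := mul_mem_contDomain hE hη hv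
  have hlim := (((tendsto_kernelForm_tmul (mul_mem_contDomain hE hηη hv) hv).const_mul
    (-4)).add ((tendsto_kernelForm_tmul hvv hηη).const_mul 2)).add
      (((tendsto_kernelForm_tmul hηv hηv).const_mul 4).sub
      ((tendsto_kernelForm_tmul (mul_mem_contDomain hE hvv hη) hη).const_mul 4))
  have hle := le_of_tendsto' hlim (b := 0) fun n =>
    (kernelForm_diffKernel_sq_mul_diffKernel_sq hE n η v).ge.trans
      (E.kernelForm_nonpos n (diffKernel η ^ 2 * diffKernel v ^ 2)
        (fun x y => by simp only [map_mul, map_pow]; positivity) (fun x => by simp))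
  rw [energy]
  linarith

theorem sum_contForm_mul_le (hE : E.IsConservative) {ι : Type*} [Fintype ι] {η : ι → C(M, ℝ)}
    {C : ι → ℝ} (hη : ∀ i, E.EnergyBounded (η i) (C i)) (hsum : ∑ i, η i * η i = 1)
    {v : C(M, ℝ)} (hv : v ∈ E.contDomain) :
    ∑ i, E.contForm (η i * v) (η i * v) ≤
      E.contForm v v + (∑ i, C i) * ∫ x, v x * v x ∂μ := by
  have hmem (i : ι) := mul_mem_contDomain hE (mul_mem_contDomain hE (hη i).1 (hη i).1) hv
  have hsumv : ∑ i, η i * η i * v = v := by rw [← Finset.sum_mul, hsum, one_mul]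
  have hform : ∑ i, E.contForm (η i * η i * v) v = E.contForm v v := by
    rw [← contForm_sum_left Finset.univ hmem hv (by rwa [hsumv]), hsumv]
  rw [← hform, Finset.sum_mul, ← Finset.sum_add_distrib]
  refine Finset.sum_le_sum fun i _ => ?_
  refine (contForm_mul_self_le hE (hη i).1 hv).trans ?_
  gcongr
  exact (hη i).2 (v * v) (mul_mem_contDomain hE hv hv) fun x => mul_self_nonneg (v x)

end Energy

end DirichletForm

theorem norm_normalize_sub_normalize_le {V : Type*} [NormedAddCommGroup V] [NormedSpace ℝ V]
    {x : V} (y : V) {δ : ℝ} (hδ : 0 < δ) (hx : δ ≤ ‖x‖) :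
    ‖NormedSpace.normalize x - NormedSpace.normalize y‖ ≤ 2 / δ * ‖x - y‖ := by
  have hsmul : ‖x‖ • (NormedSpace.normalize x - NormedSpace.normalize y) =
      x - y + (‖y‖ - ‖x‖) • NormedSpace.normalize y := by
    rw [smul_sub, sub_smul, NormedSpace.norm_smul_normalize, NormedSpace.norm_smul_normalize]
    abel
  have hy : ‖NormedSpace.normalize y‖ ≤ 1 := by
    rw [NormedSpace.normalize, norm_smul, norm_inv, norm_norm]
    exact inv_mul_le_one
  rw [div_mul_eq_mul_div, le_div_iff₀' hδ]
  calc δ * ‖NormedSpace.normalize x - NormedSpace.normalize y‖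
      ≤ ‖x‖ * ‖NormedSpace.normalize x - NormedSpace.normalize y‖ := by gcongr
    _ = ‖x - y + (‖y‖ - ‖x‖) • NormedSpace.normalize y‖ := by rw [← hsmul, norm_smul, norm_norm]
    _ ≤ ‖x - y‖ + ‖(‖y‖ - ‖x‖) • NormedSpace.normalize y‖ := norm_add_le _ _
    _ ≤ ‖x - y‖ + ‖x - y‖ * 1 := by
      rw [norm_smul, Real.norm_eq_abs, norm_sub_rev x y]
      gcongr
      exact abs_norm_sub_norm_le y x
    _ = 2 * ‖x - y‖ := by ring

/-- The map `z ↦ (uᵢ(z))ᵢ` into Euclidean space. -/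
def euclideanMap {M : Type*} [TopologicalSpace M] {ι : Type*} [Fintype ι] (u : ι → C(M, ℝ)) :
    C(M, EuclideanSpace ℝ ι) :=
  ⟨fun z => WithLp.toLp 2 fun i => u i z, by fun_prop⟩

namespace DirichletForm

section Cutoff

variable {M : Type*} [TopologicalSpace M] [CompactSpace M] [MeasurableSpace M]
  [BorelSpace M] {μ : Measure M} [IsFiniteMeasure μ] {E : DirichletForm μ}

theorem exists_energyLe_of_notMem_ball {x y : M} {r s : ℝ} (hs : 0 ≤ s) (hsr : s < r)
    (hy : y ∉ E.ball x r) : ∃ u : C(M, ℝ), E.EnergyLe u ∧ s < u x - u y := by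
  have hdist : ENNReal.ofReal s < E.dist x y :=
    ((ENNReal.ofReal_lt_ofReal_iff_of_nonneg hs).2 hsr).trans_le (not_lt.1 hy)
  obtain ⟨u, ⟨-, hu⟩, hlt⟩ := lt_biSup_iff.1 hdist
  exact ⟨u, hu, (ENNReal.ofReal_lt_ofReal_iff_of_nonneg hs).1 hlt⟩

variable [T2Space M]

theorem EnergyBounded.of_abs_sub_le (hE : E.IsConservative) {ι : Type*} [Fintype ι]
    {u : ι → C(M, ℝ)} {C : ι → ℝ} {g : C(M, ℝ)} {K : ℝ} (hu : ∀ i, E.EnergyBounded (u i) (C i))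
    (hg : ∀ x y, |g x - g y| ≤ K * ‖euclideanMap u x - euclideanMap u y‖) :
    E.EnergyBounded g (∑ i, K ^ 2 * C i) := by
  refine EnergyBounded.of_contraction hE hu (fun _ => sq_nonneg K) fun x y => ?_
  calc (g x - g y) ^ 2 = |g x - g y| ^ 2 := (sq_abs _).symm
    _ ≤ (K * ‖euclideanMap u x - euclideanMap u y‖) ^ 2 := by gcongr; exact hg x y
    _ = ∑ i, K ^ 2 * (u i x - u i y) ^ 2 := by
      simp [mul_pow, EuclideanSpace.norm_sq_eq, euclideanMap, Finset.mul_sum]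

theorem EnergyBounded.exists_normalize (hE : E.IsConservative) {ι : Type*} [Fintype ι]
    {ψ : ι → C(M, ℝ)} {C : ι → ℝ} (hψ : ∀ i, E.EnergyBounded (ψ i) (C i))
    (hne : ∀ z, euclideanMap ψ z ≠ 0) :
    ∃ (η : ι → C(M, ℝ)) (C' : ℝ), (∀ i, E.EnergyBounded (η i) C') ∧ ∑ i, η i * η i = 1 ∧
      ∀ i, Function.support (η i) ⊆ Function.support (ψ i) := by
  let w := euclideanMap ψ
  obtain ⟨δ, hδ, hw⟩ := isCompact_univ.exists_forall_le' w.continuous.norm.continuousOn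
    fun z _ => norm_pos_iff.2 (hne z)
  let N (z : M) : EuclideanSpace ℝ ι := NormedSpace.normalize (w z)
  have hN : Continuous N :=
    (w.continuous.norm.inv₀ fun z => norm_ne_zero_iff.2 (hne z)).smul w.continuous
  let η (i : ι) : C(M, ℝ) := ⟨fun z => N z i, by fun_prop⟩
  refine ⟨η, _, fun i => .of_abs_sub_le hE (K := 2 / δ) hψ fun x y => ?_, ?_, fun i z hz => ?_⟩
  · exact (PiLp.norm_apply_le (N x - N y) i).trans
      (norm_normalize_sub_normalize_le _ hδ (hw x (Set.mem_univ x)))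
  · ext z
    have hnorm : ‖N z‖ ^ 2 = 1 := by
      rw [NormedSpace.norm_normalize_eq_one_iff.2 (hne z), one_pow]
    rw [EuclideanSpace.norm_sq_eq] at hnorm
    simpa [η, ContinuousMap.sum_apply, sq] using hnorm
  · exact right_ne_zero_of_mul hz

theorem exists_cutoff (hE : E.IsConservative) (hcomp : E.DistCompatible) (x : M) {r : ℝ}
    (hr : 0 < r) :
    ∃ (ψ : C(M, ℝ)) (C : ℝ), E.EnergyBounded ψ C ∧ ψ x ≠ 0 ∧ tsupport ψ ⊆ E.ball x r := by
  obtain ⟨δ, hδ, hball⟩ := (hcomp x).mem_iff.1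
    (interior_mem_nhds.2 ((hcomp x).mem_of_mem hr))
  choose u hu hlt using fun y : ↥((interior (E.ball x r))ᶜ : Set M) =>
    exists_energyLe_of_notMem_ball (half_pos hδ).le (half_lt_self hδ) fun h => y.2 (hball h)
  obtain ⟨t, ht⟩ := isOpen_interior.isClosed_compl.isCompact.elim_finite_subcover
    (fun y => {z | δ / 2 < u y x - u y z})
    (fun y => isOpen_lt continuous_const (continuous_const.sub (u y).continuous))
    (fun z hz => Set.mem_iUnion.2 ⟨⟨z, hz⟩, hlt ⟨z, hz⟩⟩)
  let w := euclideanMap fun y : t => u y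
  let ψ : C(M, ℝ) := ⟨fun z => max (δ / 2 - ‖w x - w z‖) 0, by fun_prop⟩
  refine ⟨ψ, _, .of_abs_sub_le hE (K := 1) (fun y : t => (hu y).energyBounded) fun a b => ?_,
    ?_, fun z hz => ?_⟩
  · refine (abs_max_sub_max_le_abs _ _ _).trans ?_
    rw [one_mul, sub_sub_sub_cancel_left]
    simpa only [sub_sub_sub_cancel_left] using abs_norm_sub_norm_le (w x - w b) (w x - w a)
  · simpa [ψ] using hδ
  · have hwz : ‖w x - w z‖ ≤ δ / 2 := by
      refine closure_minimal (t := {z | ‖w x - w z‖ ≤ δ / 2}) (fun z hz => ?_)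
        (isClosed_le (by fun_prop) continuous_const) hz
      by_contra h
      exact hz (max_eq_right (sub_nonpos.2 (not_le.1 h).le))
    by_contra hzball
    obtain ⟨y, hy, hyz⟩ := Set.mem_iUnion₂.1 (ht fun h => hzball (interior_subset h))
    exact (hyz.trans_le ((le_abs_self _).trans
      (PiLp.norm_apply_le (w x - w z) ⟨y, hy⟩))).not_ge hwz

theorem exists_partition (hE : E.IsConservative) (hcomp : E.DistCompatible) {r : M → ℝ}
    (hr : ∀ x, 0 < r x) :
    ∃ (t : Finset M) (η : t → C(M, ℝ)) (C : ℝ), (∀ i, E.EnergyBounded (η i) C) ∧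
      ∑ i, η i * η i = 1 ∧ ∀ i, tsupport (η i) ⊆ E.ball i (r i) := by
  choose ψ C hψ hne hsupp using fun x => exists_cutoff hE hcomp x (hr x)
  obtain ⟨t, ht⟩ := isCompact_univ.elim_finite_subcover (fun x => {z | ψ x z ≠ 0})
    (fun x => isOpen_ne_fun (ψ x).continuous continuous_const)
    (fun x _ => Set.mem_iUnion.2 ⟨x, hne x⟩)
  obtain ⟨η, C', hη, hsum, hsub⟩ := EnergyBounded.exists_normalize hE (fun i : t => hψ i)
    fun z hz => by
      obtain ⟨x, hx, hxz⟩ := Set.mem_iUnion₂.1 (ht (Set.mem_univ z))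
      exact hxz (congrArg (fun p : EuclideanSpace ℝ t => p ⟨x, hx⟩) hz)
  exact ⟨t, η, C', hη, hsum, fun i => (closure_mono (hsub i)).trans (hsupp i)⟩

end Cutoff

end DirichletForm

theorem le_of_forall_lt_ofReal {a b : ℝ≥0∞}
    (h : ∀ A : ℝ, 0 < A → b < ENNReal.ofReal A → a ≤ ENNReal.ofReal A) : a ≤ b := by
  refine le_of_forall_gt_imp_ge_of_dense fun c hc => ?_
  obtain ⟨A, -, hbA, hAc⟩ := ENNReal.lt_iff_exists_real_btwn.1 hc
  exact (h A (ENNReal.ofReal_pos.1 (bot_le.trans_lt hbA)) hbA).trans hAc.le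

theorem eLpNorm_mul_self {M : Type*} [MeasurableSpace M] (μ : Measure M) (f : M → ℝ) (q : ℝ≥0∞) :
    eLpNorm (fun x => f x * f x) (q / 2) μ = eLpNorm f q μ ^ 2 := by
  have hpow := eLpNorm_norm_rpow (p := q / 2) (μ := μ) f (q := 2) (by norm_num)
  rw [ENNReal.ofReal_ofNat, ENNReal.div_mul_cancel (by norm_num) (by norm_num)] at hpow
  rw [← ENNReal.rpow_ofNat, ← hpow]
  simp only [Real.rpow_two, Real.norm_eq_abs, sq_abs, ← sq]

section SquarePartition

variable {M : Type*} [TopologicalSpace M] {ι : Type*} [Fintype ι] {η : ι → C(M, ℝ)}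

theorem sum_mul_apply_mul_self (hsum : ∑ i, η i * η i = 1) (v : C(M, ℝ)) (x : M) :
    ∑ i, (η i * v) x * (η i * v) x = v x * v x := by
  have hx : ∑ i, η i x * η i x = 1 := by
    simpa [ContinuousMap.sum_apply] using congrArg (fun f : C(M, ℝ) => f x) hsum
  simp only [ContinuousMap.mul_apply, mul_mul_mul_comm _ (v x), ← Finset.sum_mul, hx, one_mul]

variable [MeasurableSpace M] [BorelSpace M] {μ : Measure M}

theorem integral_mul_self_le_of_sum_eq_one [CompactSpace M] [IsFiniteMeasure μ]
    (hsum : ∑ i, η i * η i = 1) (v : C(M, ℝ)) (i : ι) :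
    ∫ x, (η i * v) x * (η i * v) x ∂μ ≤ ∫ x, v x * v x ∂μ := by
  refine integral_mono (integrable_of_compactSpace (η i * v * (η i * v)))
    (integrable_of_compactSpace (v * v)) fun x => ?_
  change _ ≤ v x * v x
  rw [← sum_mul_apply_mul_self hsum v x]
  exact Finset.single_le_sum (f := fun i => (η i * v) x * (η i * v) x)
    (fun _ _ => mul_self_nonneg _) (Finset.mem_univ i)

theorem eLpNorm_sq_le_sum_of_sum_eq_one (hsum : ∑ i, η i * η i = 1) (v : C(M, ℝ)) {q : ℝ≥0∞}
    (hq : 2 ≤ q) : eLpNorm v q μ ^ 2 ≤ ∑ i, eLpNorm (η i * v) q μ ^ 2 := by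
  have hq' : 1 ≤ q / 2 := by
    rwa [ENNReal.le_div_iff_mul_le (by simp) (by simp), one_mul]
  have hsq : (fun x => v x * v x) = ∑ i, fun x => (η i * v) x * (η i * v) x := by
    ext x
    rw [Finset.sum_apply, sum_mul_apply_mul_self hsum]
  simp only [← eLpNorm_mul_self, hsq]
  exact eLpNorm_sum_le
    (fun i _ => (η i * v * (η i * v)).continuous.aestronglyMeasurable) hq'

end SquarePartition

namespace DirichletForm

section LocalToGlobal

theorem two_lt_sobolevExponent {ν : ℝ} (hν : 2 < ν) : 2 < sobolevExponent ν := by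
  rw [sobolevExponent, ← ENNReal.ofReal_ofNat,
    ENNReal.ofReal_lt_ofReal_iff_of_nonneg zero_le_two, lt_div_iff₀ (by linarith)]
  linarith

variable {M : Type*} [TopologicalSpace M] [MeasurableSpace M] {μ : Measure M} [IsFiniteMeasure μ]
  {E : DirichletForm μ} {ν A B : ℝ} {U U' : Set M}

theorem SobolevOn.mono {A' : ℝ} (h : E.SobolevOn ν U A B) (hA : A ≤ A') (hU : U' ⊆ U) :
    E.SobolevOn ν U' A' B := fun v hv => by
  have hform := E.nonneg v
  refine (h v (hv.trans hU)).trans ?_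
  gcongr

theorem exists_sobolevOn_of_optSobolev_lt (h : E.optSobolev ν U < ENNReal.ofReal A) :
    ∃ B > 0, E.SobolevOn ν U A B := by
  simp only [optSobolev, iInf_lt_iff] at h
  obtain ⟨A', ⟨hA', B, hB, hS⟩, hlt⟩ := h
  have hle : A' ≤ A := ((ENNReal.ofReal_lt_ofReal_iff_of_nonneg hA'.le).1 hlt).le
  exact ⟨B, hB, hS.mono hle subset_rfl⟩

theorem optSobolev_le (hA : 0 < A) (h : ∃ B > 0, E.SobolevOn ν U A B) :
    E.optSobolev ν U ≤ ENNReal.ofReal A :=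
  iInf₂_le A ⟨hA, h⟩

theorem optSobolev_mono (h : U ⊆ U') : E.optSobolev ν U ≤ E.optSobolev ν U' :=
  le_iInf₂ fun _ ⟨hA, B, hB, hS⟩ => optSobolev_le hA ⟨B, hB, hS.mono le_rfl h⟩

variable [CompactSpace M] [BorelSpace M]

theorem ball_mono (x : M) : Monotone (E.ball x) :=
  fun _ _ h _ hy => hy.trans_le (ENNReal.ofReal_le_ofReal h)

/-- The local optimal Sobolev constant at `x`, that is, the limit of `A_opt(B(x, r))` as `r ↘ 0`,
encoded as an infimum since `A_opt(B(x, r))` is monotone in `r`. -/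
def optSobolevAt (E : DirichletForm μ) (ν : ℝ) (x : M) : ℝ≥0∞ :=
  ⨅ r ∈ Set.Ioi (0 : ℝ), E.optSobolev ν (E.ball x r)

theorem tendsto_optSobolevAt (E : DirichletForm μ) (ν : ℝ) (x : M) :
    Tendsto (fun r => E.optSobolev ν (E.ball x r)) (𝓝[>] 0) (𝓝 (E.optSobolevAt ν x)) := by
  rw [optSobolevAt, ← sInf_image]
  exact Monotone.tendsto_nhdsGT (fun _ _ h => optSobolev_mono (ball_mono x h)) 0

theorem optSobolevAt_le (E : DirichletForm μ) (ν : ℝ) (x : M) :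
    E.optSobolevAt ν x ≤ E.optSobolev ν Set.univ :=
  (iInf₂_le 1 (Set.mem_Ioi.2 one_pos)).trans (optSobolev_mono (Set.subset_univ _))

theorem exists_sobolevOn_ball_of_optSobolevAt_lt {x : M}
    (h : E.optSobolevAt ν x < ENNReal.ofReal A) :
    ∃ r > 0, ∃ B > 0, E.SobolevOn ν (E.ball x r) A B := by
  simp only [optSobolevAt, iInf_lt_iff] at h
  obtain ⟨r, hr, hlt⟩ := h
  exact ⟨r, hr, exists_sobolevOn_of_optSobolev_lt hlt⟩

theorem eLpNorm_toLp (f : C(M, ℝ)) (q : ℝ≥0∞) :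
    eLpNorm (ContinuousMap.toLp 2 μ ℝ f) q μ = eLpNorm f q μ :=
  eLpNorm_congr_ae (ContinuousMap.coeFn_toLp μ f)

theorem norm_toLp_sq (f : C(M, ℝ)) :
    ‖ContinuousMap.toLp 2 μ ℝ f‖ ^ 2 = ∫ x, f x * f x ∂μ := by
  rw [← real_inner_self_eq_norm_sq, inner_toLp]

theorem essSupport_toLp_subset (f : C(M, ℝ)) :
    essSupport μ (ContinuousMap.toLp 2 μ ℝ f) ⊆ tsupport f := by
  intro x hx
  by_contra hxf
  refine hx (tsupport f)ᶜ ((isClosed_tsupport f).isOpen_compl.mem_nhds hxf) ?_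
  filter_upwards [ContinuousMap.coeFn_toLp (p := 2) μ (𝕜 := ℝ) f] with y hy hyf
  rw [hy]
  exact image_eq_zero_of_notMem_tsupport hyf

theorem SobolevOn.contForm (h : E.SobolevOn ν U A B) {f : C(M, ℝ)} (hf : f ∈ E.contDomain)
    (hU : tsupport f ⊆ U) :
    eLpNorm f (sobolevExponent ν) μ ^ 2 ≤
      ENNReal.ofReal (A * E.contForm f f + B * ∫ x, f x * f x ∂μ) := by
  rw [← eLpNorm_toLp (μ := μ), ← norm_toLp_sq, contForm_eq hf hf]
  exact h ⟨_, hf⟩ ((essSupport_toLp_subset f).trans hU)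

theorem IsRegular.denseRange_toFormSpace (hreg : E.IsRegular) :
    DenseRange fun f : E.contDomain => E.toFormSpace 0 ⟨ContinuousMap.toLp 2 μ ℝ f, f.2⟩ := by
  refine Metric.denseRange_iff.2 fun v ε hε => ?_
  obtain ⟨w, ⟨f, hf, hfw⟩, hlt⟩ := hreg.2 ((E.toFormSpace 0).symm v) (ε ^ 2) (by positivity)
  obtain rfl : ⟨_, hf⟩ = w := Subtype.ext hfw
  refine ⟨⟨f, hf⟩, ?_⟩
  have hnorm := E.norm_toFormSpace_sq_le 0 ((E.toFormSpace 0).symm v - ⟨_, hf⟩)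
  rw [Nat.cast_zero, zero_add, one_mul, map_sub, LinearEquiv.apply_symm_apply] at hnorm
  rw [dist_eq_norm]
  exact lt_of_pow_lt_pow_left₀ 2 hε.le (hnorm.trans_lt hlt)

theorem IsRegular.sobolevOn_univ (hreg : E.IsRegular)
    (h : ∀ f ∈ E.contDomain, eLpNorm f (sobolevExponent ν) μ ^ 2 ≤
      ENNReal.ofReal (A * E.contForm f f + B * ∫ x, f x * f x ∂μ)) :
    E.SobolevOn ν Set.univ A B := by
  intro v _
  let φ (f : E.contDomain) : E.domain := ⟨ContinuousMap.toLp 2 μ ℝ f, f.2⟩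
  let l := comap (E.toFormSpace 0 ∘ φ) (𝓝 (E.toFormSpace 0 v))
  have : l.NeBot := comap_neBot_iff_frequently.2
    (mem_closure_iff_frequently.1 (hreg.denseRange_toFormSpace _))
  have hφ : Tendsto (fun f => E.toFormSpace 0 (φ f)) l (𝓝 (E.toFormSpace 0 v)) := tendsto_comap
  have hLp : Tendsto (fun f => (φ f : Lp ℝ 2 μ)) l (𝓝 v) :=
    ((E.formInclusion 0).continuous.tendsto _).comp hφ
  have hrhs := ENNReal.tendsto_ofReal
    (((E.tendsto_form hφ hφ).const_mul A).add ((hLp.norm.pow 2).const_mul B))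
  refine le_of_forall_gt_imp_ge_of_dense fun c hc => ?_
  rw [← ENNReal.rpow_ofNat, ← ENNReal.le_rpow_inv_iff two_pos]
  refine eLpNorm_le_of_tendstoInMeasure ?_ (tendstoInMeasure_of_tendsto_Lp hLp)
    fun f => Lp.aestronglyMeasurable _
  filter_upwards [hrhs.eventually_lt_const hc] with f hf
  rw [ENNReal.le_rpow_inv_iff two_pos, ENNReal.rpow_ofNat, eLpNorm_toLp]
  refine (h f f.2).trans (le_trans (le_of_eq ?_) hf.le)
  rw [contForm_eq f.2 f.2, norm_toLp_sq]

theorem exists_sobolevOn_univ [T2Space M] (hreg : E.IsRegular) (hE : E.IsConservative)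
    (hcomp : E.DistCompatible) (hν : 2 < ν) (hA : 0 ≤ A)
    (h : ∀ x, ∃ r > 0, ∃ B > 0, E.SobolevOn ν (E.ball x r) A B) :
    ∃ B > 0, E.SobolevOn ν Set.univ A B := by
  choose r hr B hB hS using h
  obtain ⟨t, η, C, hη, hsum, hsupp⟩ := exists_partition hE hcomp hr
  let Bsum := ∑ i : t, B i
  refine ⟨max (A * ∑ _i : t, C + Bsum) 1, lt_max_of_lt_right one_pos,
    hreg.sobolevOn_univ fun v hv => ?_⟩
  have hlocal (i : t) : eLpNorm (η i * v) (sobolevExponent ν) μ ^ 2 ≤ ENNReal.ofReal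
      (A * E.contForm (η i * v) (η i * v) + B i * ∫ x, v x * v x ∂μ) := by
    refine ((hS i).contForm (mul_mem_contDomain hE (hη i).1 hv)
      (tsupport_mul_subset_left.trans (hsupp i))).trans (ENNReal.ofReal_le_ofReal ?_)
    have := (hB i).le
    gcongr _ + B i * ?_
    exact integral_mul_self_le_of_sum_eq_one hsum v i
  have hv0 : 0 ≤ ∫ x, v x * v x ∂μ := integral_nonneg fun x => mul_self_nonneg _
  have hterm (i : t) : 0 ≤ A * E.contForm (η i * v) (η i * v) + B i * ∫ x, v x * v x ∂μ :=
    add_nonneg (mul_nonneg hA (contForm_self_nonneg _)) (mul_nonneg (hB i).le hv0)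
  calc eLpNorm v (sobolevExponent ν) μ ^ 2
      ≤ ∑ i, eLpNorm (η i * v) (sobolevExponent ν) μ ^ 2 :=
        eLpNorm_sq_le_sum_of_sum_eq_one hsum v (two_lt_sobolevExponent hν).le
    _ ≤ ∑ i : t, ENNReal.ofReal
          (A * E.contForm (η i * v) (η i * v) + B i * ∫ x, v x * v x ∂μ) :=
        Finset.sum_le_sum fun i _ => hlocal i
    _ = ENNReal.ofReal (A * ∑ i, E.contForm (η i * v) (η i * v) + Bsum * ∫ x, v x * v x ∂μ) := by
        rw [Finset.mul_sum, Finset.sum_mul, ← Finset.sum_add_distrib,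
          ENNReal.ofReal_sum_of_nonneg fun i _ => hterm i]
    _ ≤ ENNReal.ofReal (A * (E.contForm v v + (∑ _i : t, C) * ∫ x, v x * v x ∂μ) +
          Bsum * ∫ x, v x * v x ∂μ) := by
        gcongr
        exact sum_contForm_mul_le hE hη hsum hv
    _ = ENNReal.ofReal (A * E.contForm v v + (A * ∑ _i : t, C + Bsum) * ∫ x, v x * v x ∂μ) := by
        congr 1
        ring
    _ ≤ _ := by
        gcongr
        exact le_max_left _ _

theorem optSobolev_univ_eq_iSup [T2Space M] (hreg : E.IsRegular) (hE : E.IsConservative)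
    (hcomp : E.DistCompatible) (hν : 2 < ν) :
    E.optSobolev ν Set.univ = ⨆ x, E.optSobolevAt ν x := by
  refine le_antisymm (le_of_forall_lt_ofReal fun A hA hlt => optSobolev_le hA ?_)
    (iSup_le fun x => E.optSobolevAt_le ν x)
  exact exists_sobolevOn_univ hreg hE hcomp hν hA.le fun x =>
    exists_sobolevOn_ball_of_optSobolevAt_lt ((le_iSup _ x).trans_lt hlt)

end LocalToGlobal

end DirichletForm

namespace DirichletForm

section EssSupport

variable {M : Type*} [TopologicalSpace M] [MeasurableSpace M] {μ : Measure M}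

theorem notMem_essSupport {f : M → ℝ} {x : M} :
    x ∉ essSupport μ f ↔ ∃ O ∈ 𝓝 x, ∀ᵐ y ∂μ, y ∈ O → f y = 0 := by
  simp [essSupport]

theorem isClosed_essSupport (f : M → ℝ) : IsClosed (essSupport μ f) := by
  rw [← isOpen_compl_iff, isOpen_iff_mem_nhds]
  intro x hx
  obtain ⟨O, hO, hf⟩ := notMem_essSupport.1 hx
  filter_upwards [interior_mem_nhds.2 hO] with y hy
  exact notMem_essSupport.2 ⟨O, mem_interior_iff_mem_nhds.1 hy, hf⟩

theorem ae_eq_zero_of_notMem_essSupport [BorelSpace M] [IsFiniteMeasure μ] [μ.Regular]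
    {f : M → ℝ} (hf : Measurable f) : ∀ᵐ x ∂μ, x ∉ essSupport μ f → f x = 0 := by
  let s := (essSupport μ f)ᶜ ∩ {x | f x ≠ 0}
  have hs : MeasurableSet s := (isClosed_essSupport f).isOpen_compl.measurableSet.inter
    (hf (measurableSet_singleton 0).compl)
  have hnull : μ s = 0 := by
    by_contra hne
    obtain ⟨K, hKs, hK, hpos⟩ :=
      hs.exists_lt_isCompact_of_ne_top (measure_ne_top μ s) (pos_iff_ne_zero.2 hne)
    refine hpos.ne' (hK.measure_zero_of_nhdsWithin fun a ha => ?_)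
    obtain ⟨O, hO, hfO⟩ := notMem_essSupport.1 (hKs ha).1
    refine ⟨O ∩ K, inter_mem (mem_nhdsWithin_of_mem_nhds hO) self_mem_nhdsWithin,
      measure_mono_null (fun y hy => ?_) hfO⟩
    exact fun hyf => (hKs hy.2).2 (hyf hy.1)
  filter_upwards [measure_eq_zero_iff_ae_notMem.1 hnull] with x hx hxf
  by_contra hne
  exact hx ⟨hxf, hne⟩

theorem essSupport_smul_subset (c : ℝ) (v : Lp ℝ 2 μ) :
    essSupport μ (c • v : Lp ℝ 2 μ) ⊆ essSupport μ v := by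
  intro x hx O hO hv
  refine hx O hO ?_
  filter_upwards [hv, Lp.coeFn_smul c v] with y hy hcy hyO
  rw [hcy, Pi.smul_apply, hy hyO, smul_zero]

variable [BorelSpace M] [IsFiniteMeasure μ] [μ.Regular] {q : ℝ≥0∞}

theorem eLpNorm_two_le_of_essSupport_subset (v : Lp ℝ 2 μ) {O : Set M} (hO : IsOpen O)
    (hv : essSupport μ v ⊆ O) (hq : 2 ≤ q) :
    eLpNorm v 2 μ ≤ eLpNorm v q μ * μ O ^ (1 / (2 : ℝ) - 1 / q.toReal) := by
  have hind : (v : M → ℝ) =ᵐ[μ] O.indicator v := by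
    filter_upwards [ae_eq_zero_of_notMem_essSupport (Lp.stronglyMeasurable v).measurable]
      with x hx
    by_cases hxO : x ∈ O
    · rw [Set.indicator_of_mem hxO]
    · rw [Set.indicator_of_notMem hxO, hx fun h => hxO (hv h)]
  have hHolder := eLpNorm_le_eLpNorm_mul_rpow_measure_univ hq
    ((Lp.stronglyMeasurable v).aestronglyMeasurable (μ := μ.restrict O))
  rw [Measure.restrict_apply_univ, ENNReal.toReal_ofNat] at hHolder
  rw [eLpNorm_congr_ae hind, eLpNorm_indicator_eq_eLpNorm_restrict hO.measurableSet]
  refine hHolder.trans ?_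
  gcongr
  exact Measure.restrict_le_self

theorem exists_isOpen_norm_sq_le {x : M} (hx : μ {x} = 0) (hq : 2 < q) (hq' : q ≠ ⊤) {ε : ℝ}
    (hε : 0 < ε) :
    ∃ O, IsOpen O ∧ x ∈ O ∧
      ∀ v : Lp ℝ 2 μ, eLpNorm v q μ = 1 → essSupport μ v ⊆ O → ‖v‖ ^ 2 ≤ ε := by
  have hs : 0 < 1 / (2 : ℝ) - 1 / q.toReal :=
    sub_pos.2 (one_div_lt_one_div_of_lt two_pos (by
      simpa using (ENNReal.toReal_lt_toReal ENNReal.ofNat_ne_top hq').2 hq))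
  set s := 1 / (2 : ℝ) - 1 / q.toReal
  have hδ : 0 < ENNReal.ofReal √ε ^ s⁻¹ := ENNReal.rpow_pos (by simpa using hε) (by simp)
  obtain ⟨O, hxO, hO, hOδ⟩ := Set.exists_isOpen_lt_of_lt {x} _ (by rwa [hx])
  refine ⟨O, hO, hxO rfl, fun v hv hsupp => ?_⟩
  have hnorm : ‖v‖ ≤ √ε := by
    rw [Lp.norm_def]
    refine ENNReal.toReal_le_of_le_ofReal (Real.sqrt_nonneg _) ?_
    calc eLpNorm v 2 μ ≤ μ O ^ s := by
          simpa [hv, s] using eLpNorm_two_le_of_essSupport_subset v hO hsupp hq.le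
      _ ≤ (ENNReal.ofReal √ε ^ s⁻¹) ^ s := by gcongr
      _ = ENNReal.ofReal √ε := ENNReal.rpow_inv_rpow hs.ne' _
  exact (Real.le_sqrt (norm_nonneg _) hε.le).1 hnorm

end EssSupport

section FormBounded

variable {M : Type*} [MeasurableSpace M] {μ : Measure M} [IsFiniteMeasure μ]
  {E : DirichletForm μ} {V : M → ℝ}

theorem InfFormBounded.integrable (hVm : AEStronglyMeasurable V μ)
    (hV : E.InfFormBounded fun x => |V x|) (u : E.domain) :
    Integrable (fun x => V x * (u : Lp ℝ 2 μ) x ^ 2) μ := by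
  obtain ⟨c, hc⟩ := hV 1 one_pos
  refine (hc u).1.mono' (hVm.mul ((Lp.aestronglyMeasurable (u : Lp ℝ 2 μ)).pow 2))
    (ae_of_all _ fun x => ?_)
  rw [norm_mul, norm_pow, Real.norm_eq_abs, Real.norm_eq_abs, sq_abs]

end FormBounded

section LocalConstants

variable {M : Type*} [TopologicalSpace M] [MeasurableSpace M] {μ : Measure M} [IsFiniteMeasure μ]
  {E : DirichletForm μ} {ν : ℝ} {V : M → ℝ} {U U' : Set M}

theorem sobolevInv_le {u : E.domain} (hu : eLpNorm (u : Lp ℝ 2 μ) (sobolevExponent ν) μ = 1)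
    (hU : essSupport μ (u : Lp ℝ 2 μ) ⊆ U) :
    E.sobolevInv ν U ≤ ENNReal.ofReal (E.form u u) :=
  iInf₂_le u ⟨hu, hU⟩

theorem sobolevInv_anti (h : U ⊆ U') : E.sobolevInv ν U' ≤ E.sobolevInv ν U :=
  le_iInf₂ fun _ hu => sobolevInv_le hu.1 (hu.2.trans h)

theorem yamabeInv_anti (h : U ⊆ U') : E.yamabeInv ν V U' ≤ E.yamabeInv ν V U :=
  le_iInf₂ fun u hu => iInf₂_le u ⟨hu.1, hu.2.1, hu.2.2.trans h⟩

theorem sobolevInv_mul_eLpNorm_sq_le {v : E.domain}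
    (hv : eLpNorm (v : Lp ℝ 2 μ) (sobolevExponent ν) μ ≠ ⊤)
    (hU : essSupport μ (v : Lp ℝ 2 μ) ⊆ U) :
    E.sobolevInv ν U * eLpNorm (v : Lp ℝ 2 μ) (sobolevExponent ν) μ ^ 2 ≤
      ENNReal.ofReal (E.form v v) := by
  rcases eq_or_ne (eLpNorm (v : Lp ℝ 2 μ) (sobolevExponent ν) μ) 0 with hzero | hne
  · simp [hzero]
  set N := (eLpNorm (v : Lp ℝ 2 μ) (sobolevExponent ν) μ).toReal
  have hNpos : 0 < N := ENNReal.toReal_pos hne hv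
  have hNe : eLpNorm (v : Lp ℝ 2 μ) (sobolevExponent ν) μ = ENNReal.ofReal N :=
    (ENNReal.ofReal_toReal hv).symm
  have hunit : eLpNorm ((N⁻¹ • v : E.domain) : Lp ℝ 2 μ) (sobolevExponent ν) μ = 1 := by
    rw [Submodule.coe_smul, eLpNorm_congr_ae (Lp.coeFn_smul N⁻¹ (v : Lp ℝ 2 μ)),
      eLpNorm_const_smul, hNe, Real.enorm_eq_ofReal (by positivity),
      ← ENNReal.ofReal_mul (by positivity), inv_mul_cancel₀ hNpos.ne', ENNReal.ofReal_one]
  rw [hNe, ← ENNReal.ofReal_pow hNpos.le]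
  calc E.sobolevInv ν U * ENNReal.ofReal (N ^ 2)
      ≤ ENNReal.ofReal (E.form (N⁻¹ • v) (N⁻¹ • v)) * ENNReal.ofReal (N ^ 2) := by
        gcongr
        exact sobolevInv_le hunit ((essSupport_smul_subset _ _).trans hU)
    _ = ENNReal.ofReal (E.form v v) := by
        rw [← ENNReal.ofReal_mul (E.nonneg _), map_smul, map_smul, LinearMap.smul_apply,
          smul_eq_mul, smul_eq_mul]
        field_simp

theorem eLpNorm_ne_top_of_optSobolev_ne_top (hfin : E.optSobolev ν Set.univ ≠ ⊤) (v : E.domain) :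
    eLpNorm (v : Lp ℝ 2 μ) (sobolevExponent ν) μ ≠ ⊤ := by
  obtain ⟨A, -, hlt, -⟩ := ENNReal.lt_iff_exists_real_btwn.1 hfin.lt_top
  obtain ⟨B, -, hS⟩ := exists_sobolevOn_of_optSobolev_lt hlt
  exact (ENNReal.pow_lt_top_iff.1 ((hS v (Set.subset_univ _)).trans_lt ENNReal.ofReal_lt_top)
    |>.resolve_right two_ne_zero).ne

theorem optSobolev_le_inv_sobolevInv (hfin : E.optSobolev ν Set.univ ≠ ⊤) :
    E.optSobolev ν U ≤ (E.sobolevInv ν U)⁻¹ := by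
  refine le_of_forall_lt_ofReal fun A hA hlt => optSobolev_le hA ⟨1, one_pos, fun v hv => ?_⟩
  have hA' : ENNReal.ofReal A ≠ 0 := by simpa using hA
  calc eLpNorm (v : Lp ℝ 2 μ) (sobolevExponent ν) μ ^ 2
      = ENNReal.ofReal A * ((ENNReal.ofReal A)⁻¹ *
          eLpNorm (v : Lp ℝ 2 μ) (sobolevExponent ν) μ ^ 2) := by
        rw [← mul_assoc, ENNReal.mul_inv_cancel hA' ENNReal.ofReal_ne_top, one_mul]
    _ ≤ ENNReal.ofReal A * ENNReal.ofReal (E.form v v) := by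
        gcongr
        refine le_trans ?_
          (sobolevInv_mul_eLpNorm_sq_le (eLpNorm_ne_top_of_optSobolev_ne_top hfin v) hv)
        gcongr
        exact (ENNReal.inv_lt_iff_inv_lt.1 hlt).le
    _ = ENNReal.ofReal (A * E.form v v) := (ENNReal.ofReal_mul hA.le).symm
    _ ≤ ENNReal.ofReal (A * E.form v v + 1 * ‖(v : Lp ℝ 2 μ)‖ ^ 2) := by
        gcongr
        exact le_add_of_nonneg_right (by positivity)

theorem yamabeInv_le_of_sobolevInv_lt (hVm : AEStronglyMeasurable V μ)
    (hV : E.InfFormBounded fun x => |V x|) {ε t : ℝ} (hε : 0 < ε)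
    (hU : ∀ u : E.domain, eLpNorm (u : Lp ℝ 2 μ) (sobolevExponent ν) μ = 1 →
      essSupport μ (u : Lp ℝ 2 μ) ⊆ U → E.schrodinger V u ≤ (1 + ε) * E.form u u + ε)
    (ht : E.sobolevInv ν U < ENNReal.ofReal t) :
    E.yamabeInv ν V U ≤ ((1 + ε) * t + ε : ℝ) := by
  simp only [sobolevInv, iInf_lt_iff] at ht
  obtain ⟨u, ⟨hu, hsupp⟩, hut⟩ := ht
  refine (iInf₂_le u ⟨hV.integrable hVm u, hu, hsupp⟩).trans (EReal.coe_le_coe ?_)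
  have hform := ((ENNReal.ofReal_lt_ofReal_iff_of_nonneg (E.nonneg u)).1 hut).le
  refine (hU u hu hsupp).trans ?_
  gcongr

theorem sobolevInv_le_of_yamabeInv_lt {ε t : ℝ} (hε : ε < 1)
    (hU : ∀ u : E.domain, eLpNorm (u : Lp ℝ 2 μ) (sobolevExponent ν) μ = 1 →
      essSupport μ (u : Lp ℝ 2 μ) ⊆ U → (1 - ε) * E.form u u - ε ≤ E.schrodinger V u)
    (ht : E.yamabeInv ν V U < t) :
    (E.sobolevInv ν U : EReal) ≤ ((t + ε) / (1 - ε) : ℝ) := by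
  simp only [yamabeInv, iInf_lt_iff] at ht
  obtain ⟨u, ⟨-, hu, hsupp⟩, hut⟩ := ht
  refine (EReal.coe_ennreal_le_coe_ennreal_iff.2 (sobolevInv_le hu hsupp)).trans ?_
  rw [EReal.coe_ennreal_ofReal, max_eq_left (E.nonneg u), EReal.coe_le_coe_iff,
    le_div_iff₀ (sub_pos.2 hε)]
  linarith [hU u hu hsupp, EReal.coe_lt_coe_iff.1 hut]

variable [CompactSpace M] [BorelSpace M]

/-- The limit of `S(B(x, r))` as `r ↘ 0`, encoded as a supremum since `S(B(x, r))` is antitone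
in `r`. -/
def sobolevInvAt (E : DirichletForm μ) (ν : ℝ) (x : M) : ℝ≥0∞ :=
  ⨆ r ∈ Set.Ioi (0 : ℝ), E.sobolevInv ν (E.ball x r)

theorem tendsto_sobolevInvAt (E : DirichletForm μ) (ν : ℝ) (x : M) :
    Tendsto (fun r => E.sobolevInv ν (E.ball x r)) (𝓝[>] 0) (𝓝 (E.sobolevInvAt ν x)) := by
  rw [sobolevInvAt, ← sSup_image]
  exact Antitone.tendsto_nhdsGT (fun _ _ h => sobolevInv_anti (ball_mono x h)) 0

theorem sobolevInv_ball_le (E : DirichletForm μ) (ν : ℝ) (x : M) {r : ℝ} (hr : 0 < r) :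
    E.sobolevInv ν (E.ball x r) ≤ E.sobolevInvAt ν x :=
  le_iSup₂ (f := fun r (_ : r ∈ Set.Ioi (0 : ℝ)) => E.sobolevInv ν (E.ball x r)) r hr

/-- The limit of `Y(B(x, r))` as `r ↘ 0`, encoded as a supremum since `Y(B(x, r))` is antitone
in `r`. -/
def yamabeInvAt (E : DirichletForm μ) (ν : ℝ) (V : M → ℝ) (x : M) : EReal :=
  ⨆ r ∈ Set.Ioi (0 : ℝ), E.yamabeInv ν V (E.ball x r)

theorem tendsto_yamabeInvAt (E : DirichletForm μ) (ν : ℝ) (V : M → ℝ) (x : M) :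
    Tendsto (fun r => E.yamabeInv ν V (E.ball x r)) (𝓝[>] 0) (𝓝 (E.yamabeInvAt ν V x)) := by
  rw [yamabeInvAt, ← sSup_image]
  exact Antitone.tendsto_nhdsGT (fun _ _ h => yamabeInv_anti (ball_mono x h)) 0

theorem yamabeInv_ball_le (E : DirichletForm μ) (ν : ℝ) (V : M → ℝ) (x : M) {r : ℝ} (hr : 0 < r) :
    E.yamabeInv ν V (E.ball x r) ≤ E.yamabeInvAt ν V x :=
  le_iSup₂ (f := fun r (_ : r ∈ Set.Ioi (0 : ℝ)) => E.yamabeInv ν V (E.ball x r)) r hr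

variable [μ.Regular] {x : M}

theorem exists_ball_norm_sq_le (hcomp : E.DistCompatible) (hν : 2 < ν) (hx : μ {x} = 0) {ε : ℝ}
    (hε : 0 < ε) :
    ∃ r > 0, ∀ v : Lp ℝ 2 μ, eLpNorm v (sobolevExponent ν) μ = 1 →
      essSupport μ v ⊆ E.ball x r → ‖v‖ ^ 2 ≤ ε := by
  obtain ⟨O, hO, hxO, hsmall⟩ :=
    exists_isOpen_norm_sq_le hx (two_lt_sobolevExponent hν) ENNReal.ofReal_ne_top hε
  obtain ⟨r, hr, hball⟩ := (hcomp x).mem_iff.1 (hO.mem_nhds hxO)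
  exact ⟨r, hr, fun v hv hsupp => hsmall v hv (hsupp.trans hball)⟩

theorem inv_sobolevInvAt_le_optSobolevAt (hcomp : E.DistCompatible) (hν : 2 < ν)
    (hx : μ {x} = 0) : (E.sobolevInvAt ν x)⁻¹ ≤ E.optSobolevAt ν x := by
  refine le_iInf₂ fun r hr => le_iInf₂ fun A ⟨hA, B, hB, hS⟩ => ?_
  have hlower (ε : ℝ) (hε : 0 < ε) : ENNReal.ofReal ((1 - ε) / A) ≤ E.sobolevInvAt ν x := by
    obtain ⟨r', hr', hsmall⟩ := exists_ball_norm_sq_le hcomp hν hx (div_pos hε hB)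
    refine le_trans (le_iInf₂ fun u ⟨hu, hsupp⟩ => ENNReal.ofReal_le_ofReal ?_)
      (E.sobolevInv_ball_le ν x (lt_min hr hr'))
    have hnorm := hsmall u hu (hsupp.trans (ball_mono x (min_le_right r r')))
    have hsob := hS u (hsupp.trans (ball_mono x (min_le_left r r')))
    rw [hu, one_pow, ENNReal.one_le_ofReal] at hsob
    rw [le_div_iff₀' hB] at hnorm
    rw [div_le_iff₀' hA]
    linarith
  have hlim : Tendsto (fun ε : ℝ => ENNReal.ofReal ((1 - ε) / A)) (𝓝[>] 0)
      (𝓝 (ENNReal.ofReal ((1 - 0) / A))) :=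
    ((ENNReal.continuous_ofReal.comp (by fun_prop)).tendsto 0).mono_left nhdsWithin_le_nhds
  rw [ENNReal.inv_le_iff_inv_le, ← ENNReal.ofReal_inv_of_pos hA, ← one_div, ← sub_zero (1 : ℝ)]
  exact le_of_tendsto hlim (by filter_upwards [self_mem_nhdsWithin] with ε hε using hlower ε hε)

theorem optSobolevAt_eq_inv_sobolevInvAt (hcomp : E.DistCompatible) (hν : 2 < ν)
    (hx : μ {x} = 0) (hfin : E.optSobolev ν Set.univ ≠ ⊤) :
    E.optSobolevAt ν x = (E.sobolevInvAt ν x)⁻¹ := by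
  refine le_antisymm ?_ (inv_sobolevInvAt_le_optSobolevAt hcomp hν hx)
  simp only [optSobolevAt, sobolevInvAt, ENNReal.inv_iSup]
  exact iInf₂_mono fun r _ => optSobolev_le_inv_sobolevInv hfin

theorem exists_ball_abs_schrodinger_sub_form_le (hcomp : E.DistCompatible) (hν : 2 < ν)
    (hx : μ {x} = 0) (hV : E.InfFormBounded fun x => |V x|) {ε : ℝ} (hε : 0 < ε) :
    ∃ r > 0, ∀ u : E.domain, eLpNorm (u : Lp ℝ 2 μ) (sobolevExponent ν) μ = 1 →
      essSupport μ (u : Lp ℝ 2 μ) ⊆ E.ball x r →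
        |E.schrodinger V u - E.form u u| ≤ ε * E.form u u + ε := by
  obtain ⟨c, hc⟩ := hV ε hε
  obtain ⟨r, hr, hsmall⟩ := exists_ball_norm_sq_le hcomp hν hx
    (div_pos hε (by positivity : 0 < |c| + 1))
  refine ⟨r, hr, fun u hu hsupp => ?_⟩
  have hnorm : ∫ x, (u : Lp ℝ 2 μ) x ^ 2 ∂μ = ‖(u : Lp ℝ 2 μ)‖ ^ 2 := by
    rw [← real_inner_self_eq_norm_sq, L2.inner_def]
    simp [sq]
  have hc_small : c * ‖(u : Lp ℝ 2 μ)‖ ^ 2 ≤ ε :=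
    calc c * ‖(u : Lp ℝ 2 μ)‖ ^ 2 ≤ (|c| + 1) * ‖(u : Lp ℝ 2 μ)‖ ^ 2 := by
          gcongr
          linarith [le_abs_self c]
      _ ≤ ε := (le_div_iff₀' (by positivity)).1 (hsmall u hu hsupp)
  calc |E.schrodinger V u - E.form u u|
      = |∫ x, V x * (u : Lp ℝ 2 μ) x ^ 2 ∂μ| := by rw [schrodinger, add_sub_cancel_left]
    _ ≤ ∫ x, |V x| * (u : Lp ℝ 2 μ) x ^ 2 ∂μ := by
        refine abs_integral_le_integral_abs.trans (le_of_eq ?_)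
        simp only [abs_mul, abs_pow, sq_abs]
    _ ≤ ε * E.form u u + c * ‖(u : Lp ℝ 2 μ)‖ ^ 2 := hnorm ▸ (hc u).2
    _ ≤ ε * E.form u u + ε := by gcongr

theorem yamabeInvAt_le_sobolevInvAt (hcomp : E.DistCompatible) (hν : 2 < ν) (hx : μ {x} = 0)
    (hVm : AEStronglyMeasurable V μ) (hV : E.InfFormBounded fun x => |V x|) :
    E.yamabeInvAt ν V x ≤ E.sobolevInvAt ν x := by
  refine EReal.le_of_forall_lt_iff_le.1 fun t ht => ?_
  have hSt : E.sobolevInvAt ν x < ENNReal.ofReal t := by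
    rw [← EReal.coe_ennreal_lt_coe_ennreal_iff, EReal.coe_ennreal_ofReal]
    exact ht.trans_le (EReal.coe_le_coe (le_max_left _ _))
  have hupper (ε : ℝ) (hε : 0 < ε) : E.yamabeInvAt ν V x ≤ ((1 + ε) * t + ε : ℝ) := by
    obtain ⟨r', hr', hclose⟩ := exists_ball_abs_schrodinger_sub_form_le hcomp hν hx hV hε
    refine le_of_tendsto (E.tendsto_yamabeInvAt ν V x) ?_
    filter_upwards [Ioo_mem_nhdsGT hr'] with r hr
    refine yamabeInv_le_of_sobolevInv_lt hVm hV hε (fun u hu hsupp => ?_)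
      ((E.sobolevInv_ball_le ν x hr.1).trans_lt hSt)
    linarith [le_of_abs_le (hclose u hu (hsupp.trans (ball_mono x hr.2.le)))]
  have hlim : Tendsto (fun ε : ℝ => (((1 + ε) * t + ε : ℝ) : EReal)) (𝓝[>] 0) (𝓝 t) := by
    have hcont : Continuous fun ε : ℝ => (((1 + ε) * t + ε : ℝ) : EReal) :=
      continuous_coe_real_ereal.comp (by fun_prop)
    simpa using (hcont.tendsto 0).mono_left (nhdsWithin_le_nhds (s := Set.Ioi 0))
  exact ge_of_tendsto hlim (by filter_upwards [self_mem_nhdsWithin] with ε hε using hupper ε hε)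

theorem sobolevInvAt_le_yamabeInvAt (hcomp : E.DistCompatible) (hν : 2 < ν) (hx : μ {x} = 0)
    (hV : E.InfFormBounded fun x => |V x|) : E.sobolevInvAt ν x ≤ E.yamabeInvAt ν V x := by
  refine EReal.le_of_forall_lt_iff_le.1 fun t ht => ?_
  have hupper (ε : ℝ) (hε : ε ∈ Set.Ioo 0 1) :
      (E.sobolevInvAt ν x : EReal) ≤ ((t + ε) / (1 - ε) : ℝ) := by
    obtain ⟨r', hr', hclose⟩ := exists_ball_abs_schrodinger_sub_form_le hcomp hν hx hV hε.1
    refine le_of_tendsto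
      ((continuous_coe_ennreal_ereal.tendsto _).comp (E.tendsto_sobolevInvAt ν x)) ?_
    filter_upwards [Ioo_mem_nhdsGT hr'] with r hr
    refine sobolevInv_le_of_yamabeInv_lt hε.2 (fun u hu hsupp => ?_)
      ((E.yamabeInv_ball_le ν V x hr.1).trans_lt ht)
    linarith [neg_le_of_abs_le (hclose u hu (hsupp.trans (ball_mono x hr.2.le)))]
  have hlim : Tendsto (fun ε : ℝ => (((t + ε) / (1 - ε) : ℝ) : EReal)) (𝓝[>] 0) (𝓝 t) := by
    have hcont : ContinuousAt (fun ε : ℝ => (t + ε) / (1 - ε)) 0 := by fun_prop (disch := simp)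
    simpa [Function.comp_def] using (continuous_coe_real_ereal.tendsto _).comp
      (hcont.tendsto.mono_left (nhdsWithin_le_nhds (s := Set.Ioi 0)))
  exact ge_of_tendsto hlim
    (by filter_upwards [Ioo_mem_nhdsGT one_pos] with ε hε using hupper ε hε)

end LocalConstants

end DirichletForm

end

theorem mainTheorem8_general {M : Type*} [TopologicalSpace M] [CompactSpace M] [T2Space M]
    [MeasurableSpace M] [BorelSpace M] (μ : Measure M) [IsFiniteMeasure μ] [μ.Regular]
    (E : DirichletForm μ) (hreg : E.IsRegular) (hE : E.IsConservative)
    (hcomp : E.DistCompatible) (ν : ℝ) (hν : 2 < ν) :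
    ∃ a s : M → ℝ≥0∞,
      (∀ x, Tendsto (fun r : ℝ => E.optSobolev ν (E.ball x r)) (𝓝[>] 0) (𝓝 (a x))) ∧
      (∀ x, Tendsto (fun r : ℝ => E.sobolevInv ν (E.ball x r)) (𝓝[>] 0) (𝓝 (s x))) ∧
      E.optSobolev ν Set.univ = ⨆ x, a x ∧
      ((∀ x, μ {x} = 0) →
        (E.optSobolev ν Set.univ ≠ ⊤ → E.optSobolev ν Set.univ = (⨅ x, s x)⁻¹) ∧
        ∀ V : M → ℝ, Integrable V μ → E.InfFormBounded (fun x => |V x|) →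
          ∃ y : M → EReal,
            (∀ x, Tendsto (fun r : ℝ => E.yamabeInv ν V (E.ball x r)) (𝓝[>] 0) (𝓝 (y x))) ∧
            ((⨅ x, s x : ℝ≥0∞) : EReal) = ⨅ x, y x) := by
  have hglobal := DirichletForm.optSobolev_univ_eq_iSup hreg hE hcomp hν
  refine ⟨E.optSobolevAt ν, E.sobolevInvAt ν, E.tendsto_optSobolevAt ν, E.tendsto_sobolevInvAt ν,
    hglobal, fun hatom => ⟨fun hfin => ?_, fun V hVi hV =>
      ⟨E.yamabeInvAt ν V, E.tendsto_yamabeInvAt ν V, ?_⟩⟩⟩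
  · rw [hglobal, ENNReal.inv_iInf]
    exact iSup_congr fun x => DirichletForm.optSobolevAt_eq_inv_sobolevInvAt hcomp hν (hatom x) hfin
  · rw [EReal.coe_ennreal_strictMono.monotone.map_iInf_of_continuousAt
      continuous_coe_ennreal_ereal.continuousAt rfl]
    exact iInf_congr fun x => le_antisymm
      (DirichletForm.sobolevInvAt_le_yamabeInvAt hcomp hν (hatom x) hV)
      (DirichletForm.yamabeInvAt_le_sobolevInvAt hcomp hν (hatom x) hVi.aestronglyMeasurable hV)

theorem mainTheorem8 {M : Type*} [TopologicalSpace M] [CompactSpace M] [T2Space M]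
    [MeasurableSpace M] [BorelSpace M] (μ : Measure M) [IsFiniteMeasure μ] [μ.Regular]
    (E : DirichletForm μ) (hreg : E.IsRegular) (hloc : E.IsStronglyLocal)
    (hcomp : E.DistCompatible) (ν : ℝ) (hν : 2 < ν) :
    ∃ a s : M → ℝ≥0∞,
      (∀ x, Tendsto (fun r : ℝ => E.optSobolev ν (E.ball x r)) (𝓝[>] 0) (𝓝 (a x))) ∧
      (∀ x, Tendsto (fun r : ℝ => E.sobolevInv ν (E.ball x r)) (𝓝[>] 0) (𝓝 (s x))) ∧
      E.optSobolev ν Set.univ = ⨆ x, a x ∧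
      ((∀ x, μ {x} = 0) →
        (E.optSobolev ν Set.univ ≠ ⊤ → E.optSobolev ν Set.univ = (⨅ x, s x)⁻¹) ∧
        ∀ V : M → ℝ, Integrable V μ → E.InfFormBounded (fun x => |V x|) →
          ∃ y : M → EReal,
            (∀ x, Tendsto (fun r : ℝ => E.yamabeInv ν V (E.ball x r)) (𝓝[>] 0) (𝓝 (y x))) ∧
            ((⨅ x, s x : ℝ≥0∞) : EReal) = ⨅ x, y x) :=
  mainTheorem8_general μ E hreg (hloc.isConservative hreg.1) hcomp ν hν
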